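/- For integers $m,n$, a quantum channel $\mathcal M_m\to\mathcal M_n$ is a completely positive, trace-preserving linear map, where $\mathcal M_n$ denotes the complex $n\times n$ matrices. Let $\mathcal T$ be a quantum channel on $\mathcal M_d$, $d\ge 1$. Let $\delta\in[0,1)$ and $D\geq 1$. A channel $\mathcal E:\mathcal M_D\to\mathcal M_d$ is a $(D,\delta)$ classical code for $\mathcal T$ if there is a channel $\mathcal R:\mathcal M_d\to\mathcal M_D$ with $\frac1D\sum_{i=1}^D\langle i|\mathcal R\circ\mathcal T\circ\mathcal E(|i\rangle\langle i|)|i\rangle\ge 1-\delta$; it is a $(D,\delta)$ quantum code for $\mathcal T$ if there is a channel $\mathcal R:\mathcal M_d\to\mathcal M_D$ with $\langle\Phi^+|(\mathcal I\otimes(\mathcal R\circ\mathcal T\circ\mathcal E))(|\Phi^+\rangle\langle\Phi^+|)|\Phi^+\rangle\ge 1-\delta$, where $|\Phi^+\rangle=\frac1{\sqrt D}\sum_{i=1}^D|i\rangle\otimes|i\rangle$. Let $C_\delta(\mathcal T)$ and $Q_\delta(\mathcal T)$ be the supremum of $\log D$ over all $(D,\delta)$ classical codes and all $(D,\delta)$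 quantum codes for $\mathcal T$, respectively, and let $C_\delta^\infty(\mathcal T)=\lim_{t\to\infty}C_\delta(\mathcal T^t)$ and $Q_\delta^\infty(\mathcal T)=\lim_{t\to\infty}Q_\delta(\mathcal T^t)$. Let $\chi_{\mathcal T}=\operatorname{span}\{X\in\mathcal M_d:\mathcal T(X)=\lambda X\text{ for some }\lambda\in\mathbb C,\ |\lambda|=1\}$ be the peripheral subspace of $\mathcal T$, and let $\mathbb C^d=H_0\oplus\bigoplus_{k=1}^K(H_{k,1}\otimes H_{k,2})$ be an orthogonal decomposition with $$\chi_{\mathcal T}=0\oplus\bigoplus_{k=1}^K\mathcal M_{d_k}\otimes\omega_k,$$ where $d_k=\dim H_{k,1}$, $\mathcal M_{d_k}$ is the full matrix algebra on $H_{k,1}$ and $\omega_k$ is a density operator on $H_{k,2}$. Then, for every $\delta\in[0,1)$, the limits $C_\delta^\infty(\mathcal T)$ and $Q_\delta^\infty(\mathcal T)$ exist and are finite, and $$C_\delta^\infty(\mathcal T)=\log\left\lfloor\frac{\sum_{k=1}^Kd_k}{1-\delta}\right\rfloor,\qquad \log\left\lfloor\frac{\max_kd_k}{\sqrt{1-\delta}}\right\rfloor\le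 Q_\delta^\infty(\mathcal T)\le\log\left(\frac{\max_kd_k}{1-\delta}\right).$$ -/

import Mathlib

open scoped Kronecker Topology ComplexOrder

noncomputable section

namespace QCap

/-- The algebra `M_d` of complex `d × d` matrices. -/
abbrev Mat (d : ℕ) : Type := Matrix (Fin d) (Fin d) ℂ

/-- The map `I ⊗ T` on `M_k ⊗ M_m`, a matrix over `Fin k × Fin m` being read as a `k × k` matrix
of `m × m` blocks, to each of which `T` is applied. -/
def ampliation (k : ℕ) {m n : ℕ} (T : Mat m →ₗ[ℂ] Mat n)
    (X : Matrix (Fin k × Fin m) (Fin k × Fin m) ℂ) :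
    Matrix (Fin k × Fin n) (Fin k × Fin n) ℂ :=
  Matrix.of fun p q => T (Matrix.of fun i j => X (p.1, i) (q.1, j)) p.2 q.2

/-- Complete positivity: `I_k ⊗ T` preserves positive semidefiniteness for every `k`. -/
def IsCompletelyPositive {m n : ℕ} (T : Mat m →ₗ[ℂ] Mat n) : Prop :=
  ∀ (k : ℕ) (X : Matrix (Fin k × Fin m) (Fin k × Fin m) ℂ),
    X.PosSemidef → (ampliation k T X).PosSemidef

/-- A quantum channel: a completely positive and trace preserving linear map. -/
structure IsChannel {m n : ℕ} (T : Mat m →ₗ[ℂ] Mat n) : Prop where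
  completelyPositive : IsCompletelyPositive T
  trace_preserving : ∀ X : Mat m, (T X).trace = X.trace

/-- The average fidelity `(1/D) ∑ i, ⟨i| N(|i⟩⟨i|) |i⟩` over the computational basis. -/
def classicalFidelity {D : ℕ} (N : Mat D →ₗ[ℂ] Mat D) : ℝ :=
  (1 / (D : ℝ)) * ∑ i : Fin D, (N (Matrix.single i i 1) i i).re

/-- The maximally entangled vector `(1/√D) ∑ i, |i⟩ ⊗ |i⟩`. -/
def maxEntangled (D : ℕ) : Fin D × Fin D → ℂ :=
  fun p => if p.1 = p.2 then ((1 / Real.sqrt D : ℝ) : ℂ) else 0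

/-- The entanglement fidelity `⟨Φ⁺| (I ⊗ N)(|Φ⁺⟩⟨Φ⁺|) |Φ⁺⟩`. -/
def entanglementFidelity {D : ℕ} (N : Mat D →ₗ[ℂ] Mat D) : ℝ :=
  (star (maxEntangled D) ⬝ᵥ
    (ampliation D N (Matrix.vecMulVec (maxEntangled D) (star (maxEntangled D)))).mulVec
      (maxEntangled D)).re

/-- `E` is a `(D, δ)` classical code for `T`. -/
def IsClassicalCode {d : ℕ} (D : ℕ) (δ : ℝ) (T : Mat d →ₗ[ℂ] Mat d)
    (E : Mat D →ₗ[ℂ] Mat d) : Prop :=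
  IsChannel E ∧ ∃ R : Mat d →ₗ[ℂ] Mat D, IsChannel R ∧
    1 - δ ≤ classicalFidelity (R ∘ₗ T ∘ₗ E)

/-- `E` is a `(D, δ)` quantum code for `T`. -/
def IsQuantumCode {d : ℕ} (D : ℕ) (δ : ℝ) (T : Mat d →ₗ[ℂ] Mat d)
    (E : Mat D →ₗ[ℂ] Mat d) : Prop :=
  IsChannel E ∧ ∃ R : Mat d →ₗ[ℂ] Mat D, IsChannel R ∧
    1 - δ ≤ entanglementFidelity (R ∘ₗ T ∘ₗ E)

/-- The one-shot classical capacity, the supremum of `log D` over all `(D, δ)` classical codes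
with `D ≥ 1`. It is taken in the extended reals, so that it never is a junk value. -/
def classicalCapacity {d : ℕ} (δ : ℝ) (T : Mat d →ₗ[ℂ] Mat d) : EReal :=
  sSup {c : EReal | ∃ D : ℕ, 1 ≤ D ∧ (∃ E : Mat D →ₗ[ℂ] Mat d, IsClassicalCode D δ T E) ∧
    c = ((Real.log D : ℝ) : EReal)}

/-- The one-shot quantum capacity, the supremum of `log D` over all `(D, δ)` quantum codes
with `D ≥ 1`, in the extended reals. -/
def quantumCapacity {d : ℕ} (δ : ℝ) (T : Mat d →ₗ[ℂ] Mat d) : EReal :=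
  sSup {c : EReal | ∃ D : ℕ, 1 ≤ D ∧ (∃ E : Mat D →ₗ[ℂ] Mat d, IsQuantumCode D δ T E) ∧
    c = ((Real.log D : ℝ) : EReal)}

/-- The infinite-time classical capacity of `T` exists and equals the real number `c`:
the one-shot classical capacity of `T ^ t` tends to `c` as `t → ∞`. -/
def HasInfiniteTimeClassicalCapacity {d : ℕ} (δ : ℝ) (T : Module.End ℂ (Mat d)) (c : ℝ) : Prop :=
  Filter.Tendsto (fun t : ℕ => classicalCapacity δ (T ^ t)) Filter.atTop (𝓝 (c : EReal))

/-- The infinite-time quantum capacity of `T` exists and equals the real number `q`. -/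
def HasInfiniteTimeQuantumCapacity {d : ℕ} (δ : ℝ) (T : Module.End ℂ (Mat d)) (q : ℝ) : Prop :=
  Filter.Tendsto (fun t : ℕ => quantumCapacity δ (T ^ t)) Filter.atTop (𝓝 (q : EReal))

/-- The peripheral subspace of `T`: the span of its eigenvectors of modulus one eigenvalue. -/
def peripheralSubspace {d : ℕ} (T : Module.End ℂ (Mat d)) : Submodule ℂ (Mat d) :=
  Submodule.span ℂ {X : Mat d | ∃ z : ℂ, ‖z‖ = 1 ∧ T X = z • X}

/-- An index set for a basis adapted to `H₀ ⊕ ⨁ k, H_{k,1} ⊗ H_{k,2}`, where `dim H₀ = d₀`,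
`dim H_{k,1} = dk k` and `dim H_{k,2} = mk k`. -/
abbrev BlockIndex (d₀ K : ℕ) (dk mk : Fin K → ℕ) : Type :=
  Fin d₀ ⊕ (Σ k : Fin K, Fin (dk k) × Fin (mk k))

/-- The block matrix `0 ⊕ ⨁ k, x k ⊗ ω k`. -/
def blockMatrix (d₀ : ℕ) {K : ℕ} {dk mk : Fin K → ℕ} (ω : ∀ k, Mat (mk k)) (x : ∀ k, Mat (dk k)) :
    Matrix (BlockIndex d₀ K dk mk) (BlockIndex d₀ K dk mk) ℂ :=
  Matrix.fromBlocks 0 0 0 (Matrix.blockDiagonal' fun k => x k ⊗ₖ ω k)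

/-- A decomposition `ℂ^d = H₀ ⊕ ⨁ k, H_{k,1} ⊗ H_{k,2}` into orthogonal summands and density
operators `ω k` on `H_{k,2}` such that the peripheral subspace of `T` is
`0 ⊕ ⨁ k, M_{dk k} ⊗ ω k`. The decomposition of `ℂ^d` is given by the unitary matrix `W` whose
columns are the vectors of an orthonormal basis of `ℂ^d` adapted to it. -/
structure IsPeripheralDecomposition {d : ℕ} (T : Module.End ℂ (Mat d)) (d₀ K : ℕ)
    (dk mk : Fin K → ℕ) (W : Matrix (Fin d) (BlockIndex d₀ K dk mk) ℂ)
    (ω : ∀ k, Mat (mk k)) : Prop where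
  unitary_left : W.conjTranspose * W = 1
  unitary_right : W * W.conjTranspose = 1
  density_posSemidef : ∀ k, (ω k).PosSemidef
  density_trace : ∀ k, (ω k).trace = 1
  mem_iff : ∀ X : Mat d, X ∈ peripheralSubspace T ↔
    ∃ x : ∀ k, Mat (dk k), X = W * blockMatrix d₀ ω x * W.conjTranspose

end QCap

end

/-!
The powers of a channel `T` are bounded, so `T` has no eigenvalues outside the unit disc and no
nontrivial Jordan blocks on the unit circle: every matrix is the sum of a peripheral part and a
part that decays under iteration (`exists_mem_span_tendsto_pow_sub`). Since the set of channels is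
compact for pointwise convergence (`exists_subseq_tendsto_isChannel`), a subsequence of the powers
of `T` converges to a channel `P`, and by recurrence of the unimodular eigenvalues `P` can be taken
to be the projection onto the peripheral subspace (`exists_peripheral_projection`). Moreover `P`
factors as `R ∘ T ^ t` with a channel `R` for every `t` (`exists_isChannel_comp_pow_eq`), so the
evolution can be undone on the peripheral subspace. Hence a code size is available at all times if
and only if it is available for `P`: a code for `P` works for `T ^ t` after decoding by `R` first,
and codes for all `T ^ t` have a limit that is a code for `P` (`exists_limit_code`). The available
sizes decrease with `t` and are bounded, so the capacity is eventually constant, equal to the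
logarithm of the greatest size available at all times (`tendsto_sSup_log`).

It remains to bound the sizes of codes for `P`. A channel with range in the peripheral subspace
is a sum, over the blocks, of maps through `M_{dk k}`: the state `x ⊗ ω k` is prepared from `x` by a
channel, and `x` is recovered by a partial trace (`IsBlockSystem`). For a map `B ∘ A` through `M_m`
the upper bounds come from the operator inequality `Y ≤ tr(Y) 1` for positive semidefinite `Y`.
It gives `∑ i, ⟨i| B(A(|i⟩⟨i|)) |i⟩ ≤ tr B(1) = m` when the `A(|i⟩⟨i|)` have trace at most one, and,
applied to the Choi matrices of `A` and `B`, it gives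
`∑ i j, ⟨i| B(A(|i⟩⟨j|)) |j⟩ ≤ m tr A(1)`. Summed over the blocks, these say that
`D (1 - δ) ≤ ∑ k, dk k` for classical codes and `D (1 - δ) ≤ max k, dk k` for quantum codes.

Conversely, identify some coordinates of `ℂ^D` with the bases of all the `H_{k,1}`, or of a single
one. The remaining coordinates may be treated arbitrarily, because they contribute a completely
positive map, whose fidelities are nonnegative. The code so obtained has average fidelity at least
`(∑ k, dk k) / D` in the first case and entanglement fidelity at least `(dk k / D) ^ 2` in the
second (`IsBlockSystem.exists_code_pow`), which gives the lower bounds.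
-/

namespace QCap

open Matrix Filter

/-! ### Positive semidefinite matrices -/

section PosSemidef

variable {n : Type*} [Fintype n]

theorem exists_eq_conjTranspose_mul_self {M : Matrix n n ℂ} (hM : M.PosSemidef) :
    ∃ B : Matrix n n ℂ, M = Bᴴ * B := by
  classical
  open scoped MatrixOrder in
  exact CStarAlgebra.nonneg_iff_eq_star_mul_self.mp hM.nonneg

/-- Over `ℂ`, nonnegativity of the quadratic form already forces the matrix to be Hermitian. -/
theorem posSemidef_of_dotProduct_nonneg {M : Matrix n n ℂ}
    (h : ∀ x : n → ℂ, 0 ≤ star x ⬝ᵥ (M *ᵥ x)) : M.PosSemidef := by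
  classical
  rw [← Matrix.isPositive_toEuclideanLin_iff, LinearMap.isPositive_iff_complex]
  intro x
  have h0 := h x.ofLp
  have h1 : inner ℂ (M.toEuclideanLin x) x = star (star x.ofLp ⬝ᵥ (M *ᵥ x.ofLp)) := by
    rw [EuclideanSpace.inner_eq_star_dotProduct, Matrix.ofLp_toLpLin, Matrix.toLin'_apply,
      star_dotProduct, star_star, dotProduct_comm]
  rw [h1, (IsSelfAdjoint.of_nonneg h0).star_eq]
  rw [Complex.nonneg_iff] at h0
  exact ⟨Complex.ext rfl (by simpa using h0.2), h0.1⟩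

/-- A positive semidefinite matrix is dominated by its trace times the identity. -/
theorem posSemidef_trace_smul_one_sub [DecidableEq n] {M : Matrix n n ℂ} (hM : M.PosSemidef) :
    (M.trace • (1 : Matrix n n ℂ) - M).PosSemidef := by
  have htr : 0 ≤ M.trace := hM.trace_nonneg
  obtain ⟨B, rfl⟩ := exists_eq_conjTranspose_mul_self hM
  refine posSemidef_of_dotProduct_nonneg fun x => ?_
  have h1 : star x ⬝ᵥ x = ((∑ j, ‖x j‖ ^ 2 : ℝ) : ℂ) := by
    simp [dotProduct, Complex.conj_mul']
  have h2 : (Bᴴ * B).trace = ((∑ k, ∑ j, ‖B k j‖ ^ 2 : ℝ) : ℂ) := by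
    rw [Finset.sum_comm]
    simp [Matrix.trace, Matrix.mul_apply, Complex.conj_mul']
  have h3 : star x ⬝ᵥ ((Bᴴ * B) *ᵥ x) = ((∑ k, ‖(B *ᵥ x) k‖ ^ 2 : ℝ) : ℂ) := by
    rw [← mulVec_mulVec, dotProduct_mulVec, vecMul_conjTranspose, star_star]
    simp [dotProduct, Complex.conj_mul']
  have h4 (k : n) : ‖(B *ᵥ x) k‖ ^ 2 ≤ (∑ j, ‖B k j‖ ^ 2) * ∑ j, ‖x j‖ ^ 2 := by
    calc ‖(B *ᵥ x) k‖ ^ 2 ≤ (∑ j, ‖B k j‖ * ‖x j‖) ^ 2 := by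
          gcongr
          simpa [mulVec, dotProduct] using norm_sum_le Finset.univ fun j => B k j * x j
      _ ≤ _ := Finset.sum_mul_sq_le_sq_mul_sq _ _ _
  rw [sub_mulVec, smul_mulVec, one_mulVec, dotProduct_sub, dotProduct_smul, h1, h2, h3,
    smul_eq_mul, sub_nonneg, ← Complex.ofReal_mul, Complex.real_le_real, Finset.sum_mul]
  exact Finset.sum_le_sum fun k _ => h4 k

theorem trace_mul_nonneg {M N : Matrix n n ℂ} (hM : M.PosSemidef) (hN : N.PosSemidef) :
    0 ≤ (M * N).trace := by
  obtain ⟨B, rfl⟩ := exists_eq_conjTranspose_mul_self hM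
  rw [mul_assoc, trace_mul_comm]
  exact (hN.mul_mul_conjTranspose_same B).trace_nonneg

theorem trace_mul_le {M N : Matrix n n ℂ} (hM : M.PosSemidef) (hN : N.PosSemidef) :
    (M * N).trace ≤ M.trace * N.trace := by
  classical
  have := trace_mul_nonneg hM (posSemidef_trace_smul_one_sub hN)
  rw [mul_sub, trace_sub, Matrix.mul_smul, mul_one, trace_smul, smul_eq_mul, sub_nonneg] at this
  rwa [mul_comm M.trace]

theorem norm_apply_le_trace {M : Matrix n n ℂ} (hM : M.PosSemidef) (i j : n) :
    ‖M i j‖ ≤ M.trace.re := by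
  obtain ⟨B, rfl⟩ := exists_eq_conjTranspose_mul_self hM
  have h2 : (Bᴴ * B).trace.re = ∑ k, ∑ l, ‖B k l‖ ^ 2 := by
    rw [Finset.sum_comm]
    simp only [Matrix.trace, Matrix.mul_apply, Matrix.diag_apply, conjTranspose_apply,
      Complex.star_def, Complex.conj_mul', Complex.re_sum]
    norm_cast
  rw [h2, Matrix.mul_apply]
  refine (norm_sum_le _ _).trans (Finset.sum_le_sum fun k _ => ?_)
  have hi := Finset.single_le_sum (f := fun l => ‖B k l‖ ^ 2) (fun l _ => sq_nonneg _)
    (Finset.mem_univ i)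
  have hj := Finset.single_le_sum (f := fun l => ‖B k l‖ ^ 2) (fun l _ => sq_nonneg _)
    (Finset.mem_univ j)
  rw [norm_mul, conjTranspose_apply, norm_star]
  nlinarith [sq_nonneg (‖B k i‖ - ‖B k j‖)]

theorem posSemidef_of_tendsto {α : Type*} {l : Filter α} [l.NeBot] {M : α → Matrix n n ℂ}
    {N : Matrix n n ℂ} (hM : ∀ a, (M a).PosSemidef) (h : Tendsto M l (𝓝 N)) : N.PosSemidef := by
  refine posSemidef_of_dotProduct_nonneg fun x => ?_
  have hc : Continuous fun M : Matrix n n ℂ => star x ⬝ᵥ (M *ᵥ x) := by fun_prop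
  exact ge_of_tendsto' ((hc.tendsto N).comp h) fun a => (hM a).dotProduct_mulVec_nonneg x

end PosSemidef

/-! ### Completely positive maps -/

section CompletelyPositive

variable {m n p : ℕ}

/-- The completely positive map `X ↦ ∑ b, A b * X * (A b)ᴴ` with Kraus operators `A b`. -/
def krausMap {κ : Type*} [Fintype κ] (A : κ → Matrix (Fin n) (Fin m) ℂ) : Mat m →ₗ[ℂ] Mat n where
  toFun X := ∑ b, A b * X * (A b)ᴴ
  map_add' X Y := by simp [Matrix.mul_add, Matrix.add_mul, Finset.sum_add_distrib]
  map_smul' c X := by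
    simp only [Matrix.mul_smul, Matrix.smul_mul, Finset.smul_sum, RingHom.id_apply]

theorem krausMap_apply {κ : Type*} [Fintype κ] (A : κ → Matrix (Fin n) (Fin m) ℂ) (X : Mat m) :
    krausMap A X = ∑ b, A b * X * (A b)ᴴ := rfl

theorem IsCompletelyPositive.add {S T : Mat m →ₗ[ℂ] Mat n} (hS : IsCompletelyPositive S)
    (hT : IsCompletelyPositive T) : IsCompletelyPositive (S + T) := fun k X hX =>
  (hS k X hX).add (hT k X hX)

theorem IsCompletelyPositive.zero : IsCompletelyPositive (0 : Mat m →ₗ[ℂ] Mat n) := fun _ _ _ =>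
  PosSemidef.zero

theorem IsCompletelyPositive.sum {κ : Type*} {s : Finset κ} {T : κ → Mat m →ₗ[ℂ] Mat n}
    (hT : ∀ b, IsCompletelyPositive (T b)) : IsCompletelyPositive (∑ b ∈ s, T b) :=
  Finset.sum_induction _ _ (fun _ _ => .add) .zero fun b _ => hT b

theorem IsCompletelyPositive.comp {S : Mat n →ₗ[ℂ] Mat p} {T : Mat m →ₗ[ℂ] Mat n}
    (hS : IsCompletelyPositive S) (hT : IsCompletelyPositive T) :
    IsCompletelyPositive (S ∘ₗ T) := fun k X hX => hS k _ (hT k X hX)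

theorem isCompletelyPositive_id : IsCompletelyPositive (LinearMap.id : Mat m →ₗ[ℂ] Mat m) :=
  fun _ _ hX => hX

theorem isCompletelyPositive_krausMap {κ : Type*} [Fintype κ]
    (A : κ → Matrix (Fin n) (Fin m) ℂ) : IsCompletelyPositive (krausMap A) := by
  intro k X hX
  have : ampliation k (krausMap A) X =
      ∑ b, ((1 : Mat k) ⊗ₖ A b) * X * ((1 : Mat k) ⊗ₖ A b)ᴴ := by
    ext ⟨a, i⟩ ⟨c, j⟩
    simp [ampliation, krausMap_apply, Matrix.sum_apply, Matrix.mul_apply, Fintype.sum_prod_type,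
      Matrix.one_apply, Finset.sum_mul, apply_ite]
  rw [this]
  exact posSemidef_sum _ fun b _ => hX.mul_mul_conjTranspose_same _

theorem IsCompletelyPositive.posSemidef {T : Mat m →ₗ[ℂ] Mat n} (hT : IsCompletelyPositive T)
    {X : Mat m} (hX : X.PosSemidef) : (T X).PosSemidef :=
  (hT 1 _ (hX.submatrix (Prod.snd : Fin 1 × Fin m → Fin m))).submatrix fun i => ((0 : Fin 1), i)

/-- A positive functional followed by the preparation of a basis state is completely positive. -/
theorem isCompletelyPositive_smulRight (f : Mat m →ₗ[ℂ] ℂ)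
    (hf : ∀ X : Mat m, X.PosSemidef → 0 ≤ f X) (i : Fin n) :
    IsCompletelyPositive (f.smulRight (Matrix.single i i 1 : Mat n)) := by
  intro k X hX
  let G : Mat k := Matrix.of fun a b => f (Matrix.of fun s t => X (a, s) (b, t))
  have hG : G.PosSemidef := by
    refine posSemidef_of_dotProduct_nonneg fun v => ?_
    let V : Matrix (Fin k × Fin m) (Fin m) ℂ := Matrix.of fun a t => if a.2 = t then v a.1 else 0
    have hV : star v ⬝ᵥ (G *ᵥ v) = f (Vᴴ * X * V) := by
      have : Vᴴ * X * V = ∑ a, ∑ b, (star (v a) * v b) • Matrix.of fun s t => X (a, s) (b, t) := by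
        ext s t
        simp only [Matrix.mul_apply, V, conjTranspose_apply, of_apply, Fintype.sum_prod_type,
          Matrix.sum_apply, Matrix.smul_apply, smul_eq_mul, Finset.sum_mul]
        rw [Finset.sum_comm]
        simp [apply_ite, mul_right_comm]
        rw [Finset.sum_comm]
      rw [this]
      simp only [map_sum, map_smul, dotProduct, mulVec, Finset.mul_sum, G, of_apply, smul_eq_mul,
        Pi.star_apply]
      exact Finset.sum_congr rfl fun a _ => Finset.sum_congr rfl fun b _ => by ring
    rw [hV]
    exact hf _ (hX.conjTranspose_mul_mul_same V)
  let C : Matrix (Fin k × Fin n) (Fin k) ℂ :=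
    Matrix.of fun p a => if p.1 = a ∧ p.2 = i then 1 else 0
  have : ampliation k (f.smulRight (Matrix.single i i 1 : Mat n)) X = C * G * Cᴴ := by
    ext ⟨a, s⟩ ⟨b, t⟩
    simp only [ampliation, C, G, Matrix.mul_apply, Matrix.single_apply, of_apply, ite_and,
      LinearMap.smulRight_apply, Matrix.smul_apply, conjTranspose_apply, eq_comm (a := i)]
    by_cases hs : s = i <;> by_cases ht : t = i <;> simp [hs, ht, apply_ite]
  rw [this]
  exact hG.mul_mul_conjTranspose_same C

/-- A completely positive map that does not increase the trace is one branch of a channel. -/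
theorem IsCompletelyPositive.exists_isChannel_add {T : Mat m →ₗ[ℂ] Mat n}
    (hT : IsCompletelyPositive T) (htr : ∀ X : Mat m, X.PosSemidef → (T X).trace ≤ X.trace)
    (hn : 1 ≤ n) : ∃ T' : Mat m →ₗ[ℂ] Mat n, IsCompletelyPositive T' ∧ IsChannel (T + T') := by
  let f : Mat m →ₗ[ℂ] ℂ := traceLinearMap _ ℂ ℂ - traceLinearMap _ ℂ ℂ ∘ₗ T
  have hf := isCompletelyPositive_smulRight f (fun X hX => by simpa [f] using htr X hX)
    (⟨0, hn⟩ : Fin n)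
  exact ⟨_, hf, hT.add hf, fun X => by simp [f]⟩

/-- The Choi matrix `∑ a b, |a⟩⟨b| ⊗ T(|a⟩⟨b|)` of a linear map `T`. -/
def choiMatrix (T : Mat m →ₗ[ℂ] Mat n) : Matrix (Fin m × Fin n) (Fin m × Fin n) ℂ :=
  Matrix.of fun p q => T (Matrix.single p.1 q.1 1) p.2 q.2

theorem IsCompletelyPositive.posSemidef_choiMatrix {T : Mat m →ₗ[ℂ] Mat n}
    (hT : IsCompletelyPositive T) : (choiMatrix T).PosSemidef := by
  let v : Fin m × Fin m → ℂ := fun p => if p.1 = p.2 then 1 else 0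
  have : choiMatrix T = ampliation m T (vecMulVec v (star v)) := by
    ext p q
    simp only [choiMatrix, ampliation, of_apply]
    refine congrArg (fun X : Mat m => T X p.2 q.2) ?_
    ext i j
    simp only [v, vecMulVec_apply, Matrix.single_apply, ite_and, of_apply, Pi.star_apply]
    split_ifs <;> simp
  rw [this]
  exact hT m _ (posSemidef_vecMulVec_self_star v)

theorem trace_choiMatrix (T : Mat m →ₗ[ℂ] Mat n) : (choiMatrix T).trace = (T 1).trace := by
  rw [← Matrix.sum_single_one, map_sum, trace_sum]
  simp [Matrix.trace, choiMatrix, Fintype.sum_prod_type]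

theorem IsChannel.comp {S : Mat n →ₗ[ℂ] Mat p} {T : Mat m →ₗ[ℂ] Mat n}
    (hS : IsChannel S) (hT : IsChannel T) : IsChannel (S ∘ₗ T) :=
  ⟨hS.1.comp hT.1, fun X => by rw [LinearMap.comp_apply, hS.2, hT.2]⟩

theorem IsChannel.pow {T : Module.End ℂ (Mat m)} (hT : IsChannel T) (t : ℕ) :
    IsChannel (T ^ t) := by
  induction t with
  | zero => exact ⟨isCompletelyPositive_id, fun X => rfl⟩
  | succ t ih => rw [pow_succ]; exact ih.comp hT

theorem IsChannel.norm_apply_single_le {T : Mat m →ₗ[ℂ] Mat n} (hT : IsChannel T)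
    (a b : Fin m) (i j : Fin n) : ‖T (Matrix.single a b 1) i j‖ ≤ m := by
  have h := norm_apply_le_trace hT.1.posSemidef_choiMatrix (a, i) (b, j)
  rw [trace_choiMatrix, hT.2] at h
  simpa [choiMatrix] using h

theorem apply_eq_sum_single (T : Mat m →ₗ[ℂ] Mat n) (X : Mat m) :
    T X = ∑ a, ∑ b, X a b • T (Matrix.single a b 1) := by
  conv_lhs => rw [matrix_eq_sum_single X]
  simp only [map_sum, ← map_smul, Matrix.smul_single, smul_eq_mul, mul_one]

end CompletelyPositive

/-! ### Pointwise limits of channels -/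

section Limits

variable {m n : ℕ} {α : Type*} {l : Filter α}

theorem tendsto_apply_of_tendsto {S : α → Mat m →ₗ[ℂ] Mat n} {T : Mat m →ₗ[ℂ] Mat n}
    {x : α → Mat m} {X : Mat m} (hS : ∀ Y, Tendsto (fun a => S a Y) l (𝓝 (T Y)))
    (hx : Tendsto x l (𝓝 X)) : Tendsto (fun a => S a (x a)) l (𝓝 (T X)) := by
  simp_rw [fun a => apply_eq_sum_single (S a) (x a), apply_eq_sum_single T X]
  refine tendsto_finsetSum _ fun i _ => tendsto_finsetSum _ fun j _ => ?_
  exact (tendsto_pi_nhds.1 (tendsto_pi_nhds.1 hx i) j).smul (hS _)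

theorem isChannel_of_tendsto [l.NeBot] {S : α → Mat m →ₗ[ℂ] Mat n} {T : Mat m →ₗ[ℂ] Mat n}
    (hS : ∀ a, IsChannel (S a)) (h : ∀ X, Tendsto (fun a => S a X) l (𝓝 (T X))) :
    IsChannel T := by
  refine ⟨fun k X hX => posSemidef_of_tendsto (l := l) (fun a => (hS a).1 k X hX) ?_, fun X => ?_⟩
  · refine tendsto_pi_nhds.2 fun p => tendsto_pi_nhds.2 fun q => ?_
    exact tendsto_pi_nhds.1 (tendsto_pi_nhds.1 (h _) p.2) q.2
  · have hc : Continuous fun M : Mat n => M.trace := by fun_prop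
    have h1 := (hc.tendsto _).comp (h X)
    simp only [Function.comp_def, (hS _).2] at h1
    exact tendsto_nhds_unique h1 tendsto_const_nhds

/-- Sequential compactness of the set of channels for pointwise convergence. -/
theorem exists_subseq_tendsto_isChannel {S : ℕ → Mat m →ₗ[ℂ] Mat n} (hS : ∀ i, IsChannel (S i)) :
    ∃ T : Mat m →ₗ[ℂ] Mat n, IsChannel T ∧ ∃ φ : ℕ → ℕ, StrictMono φ ∧
      ∀ X, Tendsto (fun i => S (φ i) X) atTop (𝓝 (T X)) := by
  let x : ℕ → Fin m → Fin m → Fin n → Fin n → ℂ := fun i a b k l => S i (Matrix.single a b 1) k l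
  have hx (i : ℕ) : x i ∈ Metric.closedBall (0 : Fin m → Fin m → Fin n → Fin n → ℂ) m := by
    simp only [mem_closedBall_zero_iff, pi_norm_le_iff_of_nonneg (Nat.cast_nonneg (α := ℝ) m)]
    exact fun a b k l => (hS i).norm_apply_single_le a b k l
  obtain ⟨c, -, φ, hφ, hc⟩ := tendsto_subseq_of_bounded Metric.isBounded_closedBall hx
  let T : Mat m →ₗ[ℂ] Mat n :=
    ∑ a, ∑ b, (Matrix.entryLinearMap ℂ ℂ a b).smulRight (Matrix.of (c a b))
  have hT (X : Mat m) : Tendsto (fun i => S (φ i) X) atTop (𝓝 (T X)) := by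
    simp_rw [fun i => apply_eq_sum_single (S i) X]
    simp only [T, LinearMap.sum_apply, LinearMap.smulRight_apply, Matrix.entryLinearMap_apply]
    refine tendsto_finsetSum _ fun a _ => tendsto_finsetSum _ fun b _ => ?_
    exact (tendsto_pi_nhds.1 (tendsto_pi_nhds.1 hc a) b).const_smul (X a b)
  exact ⟨T, isChannel_of_tendsto (fun i => hS (φ i)) hT, φ, hφ, hT⟩

end Limits

/-! ### Power bounded operators -/

section PowerBounded

variable {V : Type*} [NormedAddCommGroup V] [NormedSpace ℂ V] {T : Module.End ℂ V}

theorem tendsto_pow_apply_zero_of_norm_lt_one {μ : ℂ} (hμ : ‖μ‖ < 1) (k : ℕ) :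
    ∀ X : V, ((T - μ • 1) ^ k) X = 0 → Tendsto (fun n : ℕ => (T ^ n) X) atTop (𝓝 0) := by
  induction k with
  | zero =>
    intro X hX
    have : X = 0 := by simpa using hX
    simp [this]
  | succ k ih =>
    intro X hX
    have hY := ih ((T - μ • 1) X) (by rwa [pow_succ, Module.End.mul_apply] at hX)
    have hstep (n : ℕ) : (T ^ (n + 1)) X = μ • (T ^ n) X + (T ^ n) ((T - μ • 1) X) := by
      rw [pow_succ, Module.End.mul_apply]
      simp
    rw [Metric.tendsto_atTop] at hY ⊢
    intro ε hε
    obtain ⟨M, hM⟩ := hY ((1 - ‖μ‖) * (ε / 2)) (mul_pos (sub_pos.2 hμ) (half_pos hε))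
    have hbound (j : ℕ) : ‖(T ^ (M + j)) X‖ ≤ ‖μ‖ ^ j * ‖(T ^ M) X‖ + ε / 2 := by
      induction j with
      | zero => simp [(half_pos hε).le]
      | succ j ihj =>
        have h1 := hM (M + j) (Nat.le_add_right _ _)
        rw [dist_zero_right] at h1
        rw [← add_assoc, hstep]
        calc _ ≤ ‖μ‖ * ‖(T ^ (M + j)) X‖ + ‖(T ^ (M + j)) ((T - μ • 1) X)‖ := by
              rw [← norm_smul]; exact norm_add_le _ _
          _ ≤ ‖μ‖ * (‖μ‖ ^ j * ‖(T ^ M) X‖ + ε / 2) + (1 - ‖μ‖) * (ε / 2) := by gcongr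
          _ = _ := by ring
    have hlim : Tendsto (fun j : ℕ => ‖μ‖ ^ j * ‖(T ^ M) X‖) atTop (𝓝 0) := by
      simpa using (tendsto_pow_atTop_nhds_zero_of_lt_one (norm_nonneg μ) hμ).mul_const _
    obtain ⟨N, hN⟩ := (hlim.eventually_lt_const (half_pos hε)).exists_forall_of_atTop
    refine ⟨M + N, fun n hn => ?_⟩
    obtain ⟨j, rfl⟩ := Nat.exists_eq_add_of_le (le_of_add_le_left hn)
    rw [dist_zero_right]
    linarith [hbound j, hN j (by omega)]

/-- A power bounded operator has no Jordan blocks of size two or more for eigenvalues of modulus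
at least one, since the powers of such a block grow at least linearly. -/
theorem apply_eq_smul_of_pow_bounded (hb : ∀ X, ∃ C, ∀ n : ℕ, ‖(T ^ n) X‖ ≤ C) {μ : ℂ}
    (hμ : 1 ≤ ‖μ‖) (k : ℕ) : ∀ X : V, ((T - μ • 1) ^ k) X = 0 → T X = μ • X := by
  induction k with
  | zero =>
    intro X hX
    have : X = 0 := by simpa using hX
    simp [this]
  | succ k ih =>
    intro X hX
    set Y := (T - μ • 1) X with hYdef
    have hY := ih Y (by rwa [pow_succ, Module.End.mul_apply] at hX)
    have hX1 : T X = μ • X + Y := by simp [hYdef]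
    have hpow (n : ℕ) : (T ^ (n + 1)) X = μ ^ (n + 1) • X + ((n + 1) * μ ^ n) • Y := by
      induction n with
      | zero => simp [hX1]
      | succ n ihn =>
        rw [pow_succ', Module.End.mul_apply, ihn, map_add, map_smul, map_smul, hY, hX1]
        push_cast
        module
    obtain ⟨C, hC⟩ := hb X
    have hC0 : 0 ≤ C := (norm_nonneg _).trans (hC 0)
    suffices hY0 : Y = 0 by rw [hX1, hY0, add_zero]
    by_contra hne
    have hYpos := norm_pos_iff.2 hne
    obtain ⟨n, hn⟩ := exists_nat_gt ((C + ‖μ‖ * ‖X‖) / ‖Y‖)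
    rw [div_lt_iff₀ hYpos] at hn
    have hr : 1 ≤ ‖μ‖ ^ n := one_le_pow₀ hμ
    have h1 : ((n : ℝ) + 1) * ‖μ‖ ^ n * ‖Y‖ ≤ C + ‖μ‖ ^ (n + 1) * ‖X‖ := by
      have h2 : (((n : ℂ) + 1) * μ ^ n) • Y = (T ^ (n + 1)) X - μ ^ (n + 1) • X := by
        rw [hpow]; abel
      have h3 := norm_sub_le ((T ^ (n + 1)) X) (μ ^ (n + 1) • X)
      rw [← h2, norm_smul, norm_smul, norm_mul, norm_pow, norm_pow] at h3
      have h4 : ‖(n : ℂ) + 1‖ = n + 1 := by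
        exact_mod_cast Complex.norm_natCast (n + 1)
      rw [h4] at h3
      linarith [hC (n + 1)]
    have h5 : ‖μ‖ ^ n * (n * ‖Y‖) ≤ ‖μ‖ ^ n * (C + ‖μ‖ * ‖X‖) := by
      have : C ≤ ‖μ‖ ^ n * C := le_mul_of_one_le_left hC0 hr
      rw [pow_succ] at h1
      nlinarith [mul_nonneg (zero_le_one.trans hr) hYpos.le]
    exact absurd (le_of_mul_le_mul_left h5 (by linarith)) (not_le.2 hn)

/-- For a power bounded operator every vector is, up to a part which decays under iteration, a
combination of eigenvectors with eigenvalues of modulus one. -/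
theorem exists_mem_span_tendsto_pow_sub [FiniteDimensional ℂ V]
    (hb : ∀ X, ∃ C, ∀ n : ℕ, ‖(T ^ n) X‖ ≤ C) (X : V) :
    ∃ Y ∈ Submodule.span ℂ {Z : V | ∃ z : ℂ, ‖z‖ = 1 ∧ T Z = z • Z},
      Tendsto (fun n : ℕ => (T ^ n) (X - Y)) atTop (𝓝 0) := by
  have hX : X ∈ ⨆ μ : ℂ, T.maxGenEigenspace μ := by
    rw [Module.End.iSup_maxGenEigenspace_eq_top]; trivial
  induction hX using Submodule.iSup_induction' with
  | mem μ X hX =>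
    obtain ⟨k, hk⟩ := (Module.End.mem_maxGenEigenspace _ _ _).1 hX
    by_cases hμ : ‖μ‖ < 1
    · exact ⟨0, zero_mem _, by simpa using tendsto_pow_apply_zero_of_norm_lt_one hμ k X hk⟩
    have hTX := apply_eq_smul_of_pow_bounded hb (not_lt.1 hμ) k X hk
    refine ⟨X, ?_, by simp⟩
    by_cases hX0 : X = 0
    · rw [hX0]; exact zero_mem _
    refine Submodule.subset_span ⟨μ, le_antisymm (not_lt.1 fun h1 => ?_) (not_lt.1 hμ), hTX⟩
    have hpow (n : ℕ) : (T ^ n) X = μ ^ n • X := by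
      induction n with
      | zero => simp
      | succ n ih => rw [pow_succ', Module.End.mul_apply, ih, map_smul, hTX, smul_smul, pow_succ]
    obtain ⟨C, hC⟩ := hb X
    obtain ⟨n, hn⟩ := ((tendsto_pow_atTop_atTop_of_one_lt h1).eventually_gt_atTop (C / ‖X‖)).exists
    rw [div_lt_iff₀ (norm_pos_iff.2 hX0)] at hn
    have := hC n
    rw [hpow, norm_smul, norm_pow] at this
    linarith
  | zero => exact ⟨0, zero_mem _, by simp⟩
  | add X₁ X₂ _ _ h₁ h₂ =>
    obtain ⟨Y₁, hY₁, ht₁⟩ := h₁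
    obtain ⟨Y₂, hY₂, ht₂⟩ := h₂
    refine ⟨Y₁ + Y₂, add_mem hY₁ hY₂, ?_⟩
    simpa [add_sub_add_comm] using ht₁.add ht₂

/-- If the powers `T ^ φ i` of a power bounded operator converge, then suitable differences `n i`
of the exponents tend to infinity and `T ^ n i` tends to a projection onto the span of the
eigenvectors with eigenvalues of modulus one. -/
theorem exists_tendsto_pow_of_convergent_subseq [FiniteDimensional ℂ V]
    (hb : ∀ X, ∃ C, ∀ n : ℕ, ‖(T ^ n) X‖ ≤ C) {φ : ℕ → ℕ} (hφ : StrictMono φ)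
    (hconv : ∀ X, ∃ L, Tendsto (fun i => (T ^ φ i) X) atTop (𝓝 L)) :
    ∃ n : ℕ → ℕ, Tendsto n atTop atTop ∧
      (∀ X ∈ Submodule.span ℂ {Z : V | ∃ z : ℂ, ‖z‖ = 1 ∧ T Z = z • Z},
        Tendsto (fun i => (T ^ n i) X) atTop (𝓝 X)) ∧
      ∀ X, ∃ Y ∈ Submodule.span ℂ {Z : V | ∃ z : ℂ, ‖z‖ = 1 ∧ T Z = z • Z},
        Tendsto (fun i => (T ^ n i) X) atTop (𝓝 Y) := by
  -- If `z ^ φ i` converges and `|z| = 1`, then `z ^ (φ j - φ i)` tends to one as `i < j` tend to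
  -- infinity. The choice `j = φ i + i` makes the difference `φ j - φ i` at least `i`.
  have hle (i : ℕ) : φ i + i ≤ φ (φ i + i) := hφ.le_apply
  have hn : Tendsto (fun i => φ (φ i + i) - φ i) atTop atTop :=
    tendsto_atTop_mono (f := fun i => i) (fun i => by have := hle i; omega) tendsto_id
  have hspan : ∀ X ∈ Submodule.span ℂ {Z : V | ∃ z : ℂ, ‖z‖ = 1 ∧ T Z = z • Z},
      Tendsto (fun i => (T ^ (φ (φ i + i) - φ i)) X) atTop (𝓝 X) := by
    intro X hX
    induction hX using Submodule.span_induction with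
    | mem X hX =>
      obtain ⟨z, hz, hTX⟩ := hX
      have hpow (n : ℕ) : (T ^ n) X = z ^ n • X := by
        induction n with
        | zero => simp
        | succ n ih => rw [pow_succ', Module.End.mul_apply, ih, map_smul, hTX, smul_smul, pow_succ]
      obtain ⟨L, hL⟩ := hconv X
      have h2 : Tendsto (fun i => φ i + i) atTop atTop :=
        tendsto_atTop_mono (fun i => Nat.le_add_left i (φ i)) tendsto_id
      have h3 := (hL.comp h2).sub hL
      rw [sub_self, tendsto_zero_iff_norm_tendsto_zero] at h3
      rw [tendsto_iff_norm_sub_tendsto_zero]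
      refine h3.congr fun i => ?_
      have h4 : φ (φ i + i) = φ i + (φ (φ i + i) - φ i) := by have := hle i; omega
      have h5 : (T ^ φ (φ i + i)) X - (T ^ φ i) X =
          z ^ φ i • ((T ^ (φ (φ i + i) - φ i)) X - X) := by
        rw [hpow, hpow, hpow, smul_sub, smul_smul, ← pow_add, ← h4]
      simp only [Function.comp_apply]
      rw [h5, norm_smul, norm_pow, hz, one_pow, one_mul]
    | zero => simp
    | add X Y _ _ h₁ h₂ => simpa using h₁.add h₂
    | smul c X _ h => simpa using h.const_smul c
  refine ⟨_, hn, hspan, fun X => ?_⟩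
  obtain ⟨Y, hY, ht⟩ := exists_mem_span_tendsto_pow_sub hb X
  refine ⟨Y, hY, ?_⟩
  simpa using (hspan Y hY).add (ht.comp hn)

end PowerBounded

/-! ### The projection onto the peripheral subspace -/

section Peripheral

variable {d : ℕ} {T : Module.End ℂ (Mat d)}

/-- Along a subsequence, the powers of a channel converge to a channel that projects onto the
peripheral subspace. -/
theorem exists_peripheral_projection (hT : IsChannel T) :
    ∃ P : Mat d →ₗ[ℂ] Mat d, IsChannel P ∧ (∀ X, P X ∈ peripheralSubspace T) ∧
      (∀ X ∈ peripheralSubspace T, P X = X) ∧ ∃ n : ℕ → ℕ, Tendsto n atTop atTop ∧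
        ∀ X, Tendsto (fun i => (T ^ n i) X) atTop (𝓝 (P X)) := by
  obtain ⟨S, -, φ, hφ, hS⟩ := exists_subseq_tendsto_isChannel (S := fun i => T ^ i) hT.pow
  obtain ⟨n, hn, hspan, hlim⟩ : ∃ n : ℕ → ℕ, Tendsto n atTop atTop ∧
      (∀ X ∈ peripheralSubspace T, Tendsto (fun i => (T ^ n i) X) atTop (𝓝 X)) ∧
      ∀ X, ∃ Y ∈ peripheralSubspace T, Tendsto (fun i => (T ^ n i) X) atTop (𝓝 Y) := by
    -- Any norm will do, as long as it induces the product topology definitionally.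
    let _ : NormedAddCommGroup (Mat d) := Matrix.normedAddCommGroup
    let _ : NormedSpace ℂ (Mat d) := Matrix.normedSpace
    refine exists_tendsto_pow_of_convergent_subseq (T := T) (fun X => ?_) hφ fun X => ⟨_, hS X⟩
    refine ⟨∑ a, ∑ b, ‖X a b‖ * d, fun k => ?_⟩
    rw [apply_eq_sum_single]
    refine (norm_sum_le _ _).trans (Finset.sum_le_sum fun a _ => (norm_sum_le _ _).trans
      (Finset.sum_le_sum fun b _ => ?_))
    rw [norm_smul]
    gcongr
    exact (Matrix.norm_le_iff (Nat.cast_nonneg d)).2 fun i j => (hT.pow k).norm_apply_single_le ..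
  obtain ⟨P, hP, ψ, hψ, hPlim⟩ :=
    exists_subseq_tendsto_isChannel (S := fun i => T ^ n i) fun i => hT.pow (n i)
  refine ⟨P, hP, fun X => ?_, fun X hX => ?_, n ∘ ψ, hn.comp hψ.tendsto_atTop, hPlim⟩
  · obtain ⟨Y, hY, hYlim⟩ := hlim X
    rwa [tendsto_nhds_unique (hPlim X) (hYlim.comp hψ.tendsto_atTop)]
  · exact tendsto_nhds_unique (hPlim X) ((hspan X hX).comp hψ.tendsto_atTop)

/-- The action of `T ^ t` on the peripheral subspace can be undone by a channel, a limit of the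
powers `T ^ (n i - t)`. -/
theorem exists_isChannel_comp_pow_eq (hT : IsChannel T) {P : Mat d →ₗ[ℂ] Mat d} {n : ℕ → ℕ}
    (hn : Tendsto n atTop atTop) (hP : ∀ X, Tendsto (fun i => (T ^ n i) X) atTop (𝓝 (P X)))
    (t : ℕ) : ∃ R : Mat d →ₗ[ℂ] Mat d, IsChannel R ∧ R ∘ₗ (T ^ t) = P := by
  obtain ⟨R, hR, φ, hφ, hlim⟩ :=
    exists_subseq_tendsto_isChannel (S := fun i => T ^ (n i - t)) fun i => hT.pow _
  refine ⟨R, hR, LinearMap.ext fun X => ?_⟩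
  refine tendsto_nhds_unique (hlim ((T ^ t) X)) (((hP X).comp hφ.tendsto_atTop).congr' ?_)
  filter_upwards [(hn.comp hφ.tendsto_atTop).eventually_ge_atTop t] with i hi
  simp only [Function.comp_apply] at hi ⊢
  rw [← Module.End.mul_apply, ← pow_add, Nat.sub_add_cancel hi]

end Peripheral

/-! ### Embedding and extracting the blocks -/

/-- Maps `ι k : M_{dk k} → M_d` and `π k : M_d → M_{dk k}` that exhibit the `M_{dk k}` as mutually
orthogonal systems in `M_d`: each `ι k` is a channel, the `π k` are the branches of a completely
positive, trace nonincreasing map, and `π l ∘ ι k` is the identity for `l = k` and zero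
otherwise. -/
structure IsBlockSystem {d : ℕ} {κ : Type*} [Fintype κ] {dk : κ → ℕ}
    (ι : ∀ k, Mat (dk k) →ₗ[ℂ] Mat d) (π : ∀ k, Mat d →ₗ[ℂ] Mat (dk k)) : Prop where
  isChannel_embed : ∀ k, IsChannel (ι k)
  isCompletelyPositive_extract : ∀ k, IsCompletelyPositive (π k)
  extract_embed_self : ∀ k x, π k (ι k x) = x
  extract_embed_ne : ∀ k l, l ≠ k → ∀ x, π l (ι k x) = 0
  sum_trace_extract_le : ∀ X : Mat d, X.PosSemidef → ∑ k, (π k X).trace ≤ X.trace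

section Blocks

variable {d d₀ K : ℕ} {dk mk : Fin K → ℕ}

/-- The isometry `x ↦ x ⊗ |b⟩` from `H_{k,1}` into `ℂ^d`, in the basis given by `W`. -/
def blockIsometry (W : Matrix (Fin d) (BlockIndex d₀ K dk mk) ℂ) (k : Fin K) (b : Fin (mk k)) :
    Matrix (Fin d) (Fin (dk k)) ℂ :=
  W.submatrix id fun a => Sum.inr ⟨k, (a, b)⟩

/-- The partial trace over `H_{k,2}` of the `k`-th diagonal block. -/
def blockExtract (W : Matrix (Fin d) (BlockIndex d₀ K dk mk) ℂ) (k : Fin K) :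
    Mat d →ₗ[ℂ] Mat (dk k) :=
  krausMap fun b => (blockIsometry W k b)ᴴ

/-- The map `x ↦ x ⊗ ω` into the `k`-th diagonal block. -/
def blockEmbed (W : Matrix (Fin d) (BlockIndex d₀ K dk mk) ℂ) (k : Fin K) (ω : Mat (mk k)) :
    Mat (dk k) →ₗ[ℂ] Mat d where
  toFun x := ∑ b, ∑ c, ω b c • (blockIsometry W k b * x * (blockIsometry W k c)ᴴ)
  map_add' x y := by simp [Matrix.mul_add, Matrix.add_mul, Finset.sum_add_distrib]
  map_smul' z x := by
    simp only [Matrix.mul_smul, Matrix.smul_mul, Finset.smul_sum, RingHom.id_apply,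
      smul_comm z]

theorem blockEmbed_apply (W : Matrix (Fin d) (BlockIndex d₀ K dk mk) ℂ) (k : Fin K)
    (ω : Mat (mk k)) (x : Mat (dk k)) : blockEmbed W k ω x =
      ∑ b, ∑ c, ω b c • (blockIsometry W k b * x * (blockIsometry W k c)ᴴ) := rfl

theorem isCompletelyPositive_blockEmbed (W : Matrix (Fin d) (BlockIndex d₀ K dk mk) ℂ)
    (k : Fin K) {ω : Mat (mk k)} (hω : ω.PosSemidef) :
    IsCompletelyPositive (blockEmbed W k ω) := by
  obtain ⟨B, rfl⟩ := exists_eq_conjTranspose_mul_self hω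
  have : blockEmbed W k (Bᴴ * B) = krausMap fun e => ∑ b, star (B e b) • blockIsometry W k b := by
    refine LinearMap.ext fun x => ?_
    simp only [blockEmbed_apply, krausMap_apply, Matrix.mul_apply, conjTranspose_apply,
      Finset.sum_smul, conjTranspose_sum, conjTranspose_smul, star_star, Matrix.sum_mul,
      Matrix.mul_sum, Matrix.smul_mul, Matrix.mul_smul, Finset.smul_sum, smul_smul]
    rw [Finset.sum_comm_cycle]
    refine Finset.sum_congr rfl fun e _ => ?_
    rw [Finset.sum_comm]
    refine Finset.sum_congr rfl fun e _ => Finset.sum_congr rfl fun b _ => ?_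
    rw [mul_comm]
  rw [this]
  exact isCompletelyPositive_krausMap _

theorem conj_blockMatrix_eq_sum (W : Matrix (Fin d) (BlockIndex d₀ K dk mk) ℂ)
    (ω : ∀ k, Mat (mk k)) (x : ∀ k, Mat (dk k)) :
    W * blockMatrix d₀ ω x * Wᴴ = ∑ k, blockEmbed W k (ω k) (x k) := by
  ext i j
  have hne (k l : Fin K) (h : l ≠ k) (p : Fin (dk l) × Fin (mk l)) (q : Fin (dk k) × Fin (mk k)) :
      blockDiagonal' (fun k => x k ⊗ₖ ω k) ⟨l, p⟩ ⟨k, q⟩ = 0 := blockDiagonal'_apply_ne _ _ _ h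
  have hcol (k : Fin K) (a' : Fin (dk k)) (c : Fin (mk k)) :
      (W * blockMatrix d₀ ω x) i (Sum.inr ⟨k, (a', c)⟩) =
        ∑ a, ∑ b, W i (Sum.inr ⟨k, (a, b)⟩) * (x k a a' * ω k b c) := by
    simp only [Matrix.mul_apply, blockMatrix, Fintype.sum_sum_type, Fintype.sum_sigma,
      fromBlocks_apply₁₂, fromBlocks_apply₂₂, Matrix.zero_apply, mul_zero, Finset.sum_const_zero,
      zero_add]
    rw [Finset.sum_eq_single k (fun l _ hl => by simp [hne k l hl]) (by simp)]
    simp [Fintype.sum_prod_type, blockDiagonal'_apply_eq]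
  rw [Matrix.mul_apply, Fintype.sum_sum_type, Fintype.sum_sigma]
  have hinl (s : Fin d₀) : (W * blockMatrix d₀ ω x) i (Sum.inl s) = 0 := by
    simp [Matrix.mul_apply, blockMatrix, Fintype.sum_sum_type]
  simp only [hinl, zero_mul, Finset.sum_const_zero, zero_add, Fintype.sum_prod_type, hcol,
    Matrix.sum_apply, blockEmbed_apply, Matrix.smul_apply, smul_eq_mul, Matrix.mul_apply,
    Finset.sum_mul, Finset.mul_sum, blockIsometry, submatrix_apply, id, conjTranspose_apply]
  refine Finset.sum_congr rfl fun k _ => ?_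
  trans ∑ a', ∑ c, ∑ b, ∑ a, W i (Sum.inr ⟨k, (a, b)⟩) * (x k a a' * ω k b c) *
    star (W j (Sum.inr ⟨k, (a', c)⟩))
  · exact Finset.sum_congr rfl fun _ _ => Finset.sum_congr rfl fun _ _ => Finset.sum_comm
  rw [Finset.sum_comm_cycle]
  refine Finset.sum_congr rfl fun b _ => ?_
  rw [Finset.sum_comm]
  refine Finset.sum_congr rfl fun c _ => Finset.sum_congr rfl fun a' _ =>
    Finset.sum_congr rfl fun a _ => by ring

variable {T : Module.End ℂ (Mat d)} {W : Matrix (Fin d) (BlockIndex d₀ K dk mk) ℂ}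
  {ω : ∀ k, Mat (mk k)}

theorem blockIsometry_conjTranspose_mul (hW : Wᴴ * W = 1) (k : Fin K) (b c : Fin (mk k)) :
    (blockIsometry W k b)ᴴ * blockIsometry W k c = if b = c then 1 else 0 := by
  ext i j
  have h := congrFun (congrFun hW (Sum.inr ⟨k, (i, b)⟩)) (Sum.inr ⟨k, (j, c)⟩)
  rw [Matrix.mul_apply] at h ⊢
  refine Eq.trans h ?_
  by_cases hbc : b = c <;> by_cases hij : i = j <;> simp [Matrix.one_apply, hbc, hij]

theorem blockIsometry_conjTranspose_mul_of_ne (hW : Wᴴ * W = 1) {k l : Fin K} (hkl : l ≠ k)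
    (b : Fin (mk l)) (c : Fin (mk k)) :
    (blockIsometry W l b)ᴴ * blockIsometry W k c = 0 := by
  ext i j
  have h := congrFun (congrFun hW (Sum.inr ⟨l, (i, b)⟩)) (Sum.inr ⟨k, (j, c)⟩)
  rw [Matrix.mul_apply] at h ⊢
  refine Eq.trans h ?_
  simp [hkl]

theorem trace_blockEmbed (hW : Wᴴ * W = 1) (k : Fin K) {ω : Mat (mk k)} (hω : ω.trace = 1)
    (x : Mat (dk k)) : (blockEmbed W k ω x).trace = x.trace := by
  have h (b c : Fin (mk k)) : (blockIsometry W k b * x * (blockIsometry W k c)ᴴ).trace =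
      if c = b then x.trace else 0 := by
    rw [trace_mul_comm, ← Matrix.mul_assoc, blockIsometry_conjTranspose_mul hW]
    split_ifs <;> simp
  simp only [blockEmbed_apply, trace_sum, trace_smul, h]
  simp only [smul_eq_mul, mul_ite, mul_zero, Finset.sum_ite_eq', Finset.mem_univ, if_true,
    ← Finset.sum_mul]
  rw [show ∑ b, ω b b = 1 from hω, one_mul]

theorem blockExtract_blockEmbed (hW : Wᴴ * W = 1) (k : Fin K) {ω : Mat (mk k)} (hω : ω.trace = 1)
    (x : Mat (dk k)) : blockExtract W k (blockEmbed W k ω x) = x := by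
  have h (e b c : Fin (mk k)) : (blockIsometry W k e)ᴴ * (blockIsometry W k b * x *
      (blockIsometry W k c)ᴴ) * blockIsometry W k e = if e = b then if c = e then x else 0 else 0 := by
    rw [Matrix.mul_assoc, Matrix.mul_assoc, Matrix.mul_assoc, ← Matrix.mul_assoc,
      blockIsometry_conjTranspose_mul hW, blockIsometry_conjTranspose_mul hW]
    split_ifs <;> simp
  simp only [blockExtract, krausMap_apply, blockEmbed_apply, conjTranspose_conjTranspose,
    Matrix.mul_sum, Matrix.sum_mul, Matrix.mul_smul, Matrix.smul_mul, h]
  simp only [smul_ite, smul_zero, Finset.sum_ite_eq, Finset.sum_ite_eq', Finset.mem_univ, if_true,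
    ← Finset.sum_smul, Finset.sum_ite_irrel, Finset.sum_const_zero]
  rw [show ∑ b, ω b b = 1 from hω, one_smul]

theorem blockExtract_blockEmbed_of_ne (hW : Wᴴ * W = 1) {k l : Fin K} (hkl : l ≠ k)
    (ω : Mat (mk k)) (x : Mat (dk k)) : blockExtract W l (blockEmbed W k ω x) = 0 := by
  have h (e : Fin (mk l)) (b c : Fin (mk k)) : (blockIsometry W l e)ᴴ * (blockIsometry W k b * x *
      (blockIsometry W k c)ᴴ) * blockIsometry W l e = 0 := by
    rw [← Matrix.mul_assoc, ← Matrix.mul_assoc, blockIsometry_conjTranspose_mul_of_ne hW hkl]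
    simp
  simp [blockExtract, krausMap_apply, blockEmbed_apply, h]

theorem sum_trace_blockExtract_le (hW : W * Wᴴ = 1) {X : Mat d} (hX : X.PosSemidef) :
    ∑ k, (blockExtract W k X).trace ≤ X.trace := by
  have h1 : X.trace = (Wᴴ * X * W).trace := by
    rw [trace_mul_comm, ← Matrix.mul_assoc, hW, Matrix.one_mul]
  have h2 (k : Fin K) : (blockExtract W k X).trace =
      ∑ a, ∑ b, (Wᴴ * X * W) (Sum.inr ⟨k, (a, b)⟩) (Sum.inr ⟨k, (a, b)⟩) := by
    rw [Finset.sum_comm, blockExtract, krausMap_apply, trace_sum]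
    simp [Matrix.trace, Matrix.mul_apply, blockIsometry]
  rw [h1, Matrix.trace, Fintype.sum_sum_type, Fintype.sum_sigma]
  simp only [h2, Fintype.sum_prod_type, diag_apply]
  exact le_add_of_nonneg_left (Finset.sum_nonneg fun s _ =>
    (hX.conjTranspose_mul_mul_same W).diag_nonneg)

theorem IsPeripheralDecomposition.isBlockSystem
    (hW : IsPeripheralDecomposition T d₀ K dk mk W ω) :
    IsBlockSystem (fun k => blockEmbed W k (ω k)) (blockExtract W) where
  isChannel_embed k := ⟨isCompletelyPositive_blockEmbed W k (hW.density_posSemidef k),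
    trace_blockEmbed hW.unitary_left k (hW.density_trace k)⟩
  isCompletelyPositive_extract _ := isCompletelyPositive_krausMap _
  extract_embed_self k := blockExtract_blockEmbed hW.unitary_left k (hW.density_trace k)
  extract_embed_ne k _ h := blockExtract_blockEmbed_of_ne hW.unitary_left h (ω k)
  sum_trace_extract_le _ hX := sum_trace_blockExtract_le hW.unitary_right hX

theorem IsPeripheralDecomposition.blockEmbed_mem
    (hW : IsPeripheralDecomposition T d₀ K dk mk W ω) (k : Fin K) (x : Mat (dk k)) :
    blockEmbed W k (ω k) x ∈ peripheralSubspace T := by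
  refine (hW.mem_iff _).2 ⟨Pi.single k x, ?_⟩
  rw [conj_blockMatrix_eq_sum, Finset.sum_eq_single k (fun l _ hl => by simp [hl]) (by simp),
    Pi.single_eq_same]

theorem IsPeripheralDecomposition.sum_embed_extract
    (hW : IsPeripheralDecomposition T d₀ K dk mk W ω) {X : Mat d}
    (hX : X ∈ peripheralSubspace T) :
    ∑ k, blockEmbed W k (ω k) (blockExtract W k X) = X := by
  obtain ⟨x, rfl⟩ := (hW.mem_iff _).1 hX
  rw [conj_blockMatrix_eq_sum]
  refine Finset.sum_congr rfl fun k _ => ?_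
  rw [map_sum, Finset.sum_eq_single k
    (fun l _ hl => hW.isBlockSystem.extract_embed_ne l k hl.symm _) (by simp),
    hW.isBlockSystem.extract_embed_self]

end Blocks

/-! ### Fidelities as linear functionals -/

section Fidelity

variable {D m : ℕ}

/-- The unnormalized average fidelity `∑ i, ⟨i| N(|i⟩⟨i|) |i⟩`. -/
def classicalOverlap (N : Mat D →ₗ[ℂ] Mat D) : ℂ :=
  ∑ i, N (Matrix.single i i 1) i i

/-- The unnormalized entanglement fidelity `∑ i j, ⟨i| N(|i⟩⟨j|) |j⟩`. -/
def quantumOverlap (N : Mat D →ₗ[ℂ] Mat D) : ℂ :=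
  ∑ i, ∑ j, N (Matrix.single i j 1) i j

theorem classicalOverlap_add (M N : Mat D →ₗ[ℂ] Mat D) :
    classicalOverlap (M + N) = classicalOverlap M + classicalOverlap N := by
  simp [classicalOverlap, Finset.sum_add_distrib]

theorem quantumOverlap_add (M N : Mat D →ₗ[ℂ] Mat D) :
    quantumOverlap (M + N) = quantumOverlap M + quantumOverlap N := by
  simp [quantumOverlap, Finset.sum_add_distrib]

theorem classicalOverlap_sum {κ : Type*} (s : Finset κ) (N : κ → Mat D →ₗ[ℂ] Mat D) :
    classicalOverlap (∑ k ∈ s, N k) = ∑ k ∈ s, classicalOverlap (N k) := by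
  simp only [classicalOverlap, LinearMap.sum_apply, Matrix.sum_apply]
  exact Finset.sum_comm

theorem quantumOverlap_sum {κ : Type*} (s : Finset κ) (N : κ → Mat D →ₗ[ℂ] Mat D) :
    quantumOverlap (∑ k ∈ s, N k) = ∑ k ∈ s, quantumOverlap (N k) := by
  simp only [quantumOverlap, LinearMap.sum_apply, Matrix.sum_apply]
  exact Finset.sum_comm_cycle

theorem posSemidef_single (i : Fin D) : (Matrix.single i i 1 : Mat D).PosSemidef := by
  rw [← Matrix.diagonal_single]
  exact PosSemidef.diagonal (Pi.single_nonneg.2 zero_le_one)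

theorem classicalOverlap_nonneg {N : Mat D →ₗ[ℂ] Mat D} (hN : IsCompletelyPositive N) :
    0 ≤ classicalOverlap N :=
  Finset.sum_nonneg fun i _ => (hN.posSemidef (posSemidef_single i)).diag_nonneg

theorem quantumOverlap_nonneg {N : Mat D →ₗ[ℂ] Mat D} (hN : IsCompletelyPositive N) :
    0 ≤ quantumOverlap N := by
  convert hN.posSemidef_choiMatrix.dotProduct_mulVec_nonneg fun p => if p.1 = p.2 then 1 else 0
  simp [quantumOverlap, choiMatrix, dotProduct, mulVec, Fintype.sum_prod_type]

theorem re_classicalOverlap (hD : 1 ≤ D) (N : Mat D →ₗ[ℂ] Mat D) :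
    (classicalOverlap N).re = D * classicalFidelity N := by
  have : (D : ℝ) ≠ 0 := by positivity
  rw [classicalFidelity, ← mul_assoc, mul_one_div_cancel this, one_mul, classicalOverlap,
    Complex.re_sum]

theorem re_quantumOverlap (hD : 1 ≤ D) (N : Mat D →ₗ[ℂ] Mat D) :
    (quantumOverlap N).re = D ^ 2 * entanglementFidelity N := by
  have hD0 : (D : ℂ) ≠ 0 := by exact_mod_cast (by omega : D ≠ 0)
  have hsq : (((1 / Real.sqrt D : ℝ) : ℂ)) * ((1 / Real.sqrt D : ℝ) : ℂ) = (D : ℂ)⁻¹ := by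
    rw [← Complex.ofReal_mul, div_mul_div_comm, Real.mul_self_sqrt (Nat.cast_nonneg D)]
    simp
  have hamp (i j k l : Fin D) : ampliation D N
      (Matrix.vecMulVec (maxEntangled D) (star (maxEntangled D))) (i, k) (j, l) =
      (D : ℂ)⁻¹ * N (Matrix.single i j 1) k l := by
    have : (Matrix.of fun s t => Matrix.vecMulVec (maxEntangled D) (star (maxEntangled D))
        (i, s) (j, t) : Mat D) = (D : ℂ)⁻¹ • Matrix.single i j 1 := by
      ext s t
      simp only [of_apply, vecMulVec_apply, maxEntangled, Pi.star_apply, Matrix.smul_apply,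
        Matrix.single_apply, ← hsq, ite_and]
      split_ifs <;> simp
    rw [ampliation, of_apply, this, map_smul, Matrix.smul_apply, smul_eq_mul]
  have hsum : star (maxEntangled D) ⬝ᵥ (ampliation D N (Matrix.vecMulVec (maxEntangled D)
      (star (maxEntangled D)))).mulVec (maxEntangled D) = (D : ℂ)⁻¹ ^ 2 * quantumOverlap N := by
    simp only [dotProduct, mulVec, Fintype.sum_prod_type, hamp, maxEntangled, Pi.star_apply,
      mul_ite, mul_zero, Finset.sum_ite_eq, Finset.mem_univ, if_true, apply_ite star, star_zero,
      ite_mul, zero_mul]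
    simp only [quantumOverlap, Finset.mul_sum]
    refine Finset.sum_congr rfl fun i _ => Finset.sum_congr rfl fun j _ => ?_
    rw [Complex.star_def, Complex.conj_ofReal, sq]
    linear_combination (D : ℂ)⁻¹ * N (Matrix.single i j 1) i j * hsq
  have h1 : quantumOverlap N = ((D ^ 2 : ℝ) : ℂ) * ((D : ℂ)⁻¹ ^ 2 * quantumOverlap N) := by
    push_cast
    field_simp
  rw [entanglementFidelity, hsum, h1, Complex.re_ofReal_mul, ← h1]

/-! ### Upper bounds on the fidelity -/

/-- At most `m` classical messages pass through an `m`-dimensional system. -/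
theorem classicalOverlap_comp_le {A : Mat D →ₗ[ℂ] Mat m} {B : Mat m →ₗ[ℂ] Mat D}
    (hA : IsCompletelyPositive A) (hB : IsChannel B)
    (htr : ∀ i, (A (Matrix.single i i 1)).trace ≤ 1) : classicalOverlap (B ∘ₗ A) ≤ m := by
  have h1 (i : Fin D) : B (A (Matrix.single i i 1)) i i ≤ B 1 i i := by
    have hpos := hA.posSemidef (posSemidef_single i)
    have h2 := (hB.1.posSemidef (posSemidef_trace_smul_one_sub hpos)).diag_nonneg (i := i)
    rw [map_sub, map_smul, Matrix.sub_apply, Matrix.smul_apply, smul_eq_mul, sub_nonneg] at h2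
    exact h2.trans (mul_le_of_le_one_left (hB.1.posSemidef PosSemidef.one).diag_nonneg (htr i))
  calc classicalOverlap (B ∘ₗ A) ≤ ∑ i, B 1 i i := Finset.sum_le_sum fun i _ => h1 i
    _ = (B 1).trace := rfl
    _ = m := by rw [hB.2, trace_one, Fintype.card_fin]

/-- A map that factors through an `m`-dimensional system has unnormalized entanglement fidelity at
most `m * tr A(1)`: the overlap is the trace of the product of the Choi
matrices of the two factors. -/
theorem quantumOverlap_comp_le {A : Mat D →ₗ[ℂ] Mat m} {B : Mat m →ₗ[ℂ] Mat D}
    (hA : IsCompletelyPositive A) (hB : IsChannel B) :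
    quantumOverlap (B ∘ₗ A) ≤ m * (A 1).trace := by
  have h := trace_mul_le hA.posSemidef_choiMatrix
    (hB.1.posSemidef_choiMatrix.transpose.submatrix Prod.swap)
  have h1 : ((choiMatrix A) * (choiMatrix B)ᵀ.submatrix Prod.swap Prod.swap).trace =
      quantumOverlap (B ∘ₗ A) := by
    simp only [quantumOverlap, LinearMap.comp_apply, Matrix.trace, diag_apply, Matrix.mul_apply,
      Fintype.sum_prod_type]
    refine Finset.sum_congr rfl fun i _ => ?_
    rw [Finset.sum_comm]
    refine Finset.sum_congr rfl fun j _ => ?_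
    rw [apply_eq_sum_single B, Matrix.sum_apply]
    refine Finset.sum_congr rfl fun a _ => ?_
    rw [Matrix.sum_apply]
    rfl
  have h2 : ((choiMatrix B)ᵀ.submatrix Prod.swap Prod.swap).trace = (choiMatrix B).trace :=
    Fintype.sum_equiv (Equiv.prodComm _ _) _ _ fun _ => rfl
  rw [h1, h2, trace_choiMatrix, trace_choiMatrix, hB.2, trace_one, Fintype.card_fin] at h
  rwa [mul_comm]

variable {d : ℕ} {κ : Type*} [Fintype κ] {dk : κ → ℕ} {ι : ∀ k, Mat (dk k) →ₗ[ℂ] Mat d}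
  {π : ∀ k, Mat d →ₗ[ℂ] Mat (dk k)}

theorem comp_eq_sum_comp_blocks {S : Mat D →ₗ[ℂ] Mat d} (hS : ∀ X, ∑ k, ι k (π k (S X)) = S X)
    (R : Mat d →ₗ[ℂ] Mat D) : R ∘ₗ S = ∑ k, (R ∘ₗ ι k) ∘ₗ (π k ∘ₗ S) := by
  refine LinearMap.ext fun X => ?_
  simp only [LinearMap.comp_apply, LinearMap.sum_apply, ← map_sum, hS]

/-- Codes for a channel with values in the span of the blocks have size at most the total dimension
of the blocks, divided by the fidelity. -/
theorem IsBlockSystem.mul_classicalFidelity_le (h : IsBlockSystem ι π) (hD : 1 ≤ D)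
    {S : Mat D →ₗ[ℂ] Mat d} (hS : IsChannel S) (hSum : ∀ X, ∑ k, ι k (π k (S X)) = S X)
    {R : Mat d →ₗ[ℂ] Mat D} (hR : IsChannel R) :
    D * classicalFidelity (R ∘ₗ S) ≤ (∑ k, dk k : ℕ) := by
  have hle : classicalOverlap (R ∘ₗ S) ≤ ((∑ k, dk k : ℕ) : ℂ) := by
    rw [comp_eq_sum_comp_blocks hSum, classicalOverlap_sum, Nat.cast_sum]
    refine Finset.sum_le_sum fun k _ => classicalOverlap_comp_le
      ((h.isCompletelyPositive_extract k).comp hS.1) (hR.comp (h.isChannel_embed k)) fun i => ?_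
    have hpos := hS.1.posSemidef (posSemidef_single i)
    calc (π k (S (Matrix.single i i 1))).trace ≤ ∑ l, (π l (S (Matrix.single i i 1))).trace :=
          Finset.single_le_sum (fun l _ => ((h.isCompletelyPositive_extract l).posSemidef
            hpos).trace_nonneg) (Finset.mem_univ k)
      _ ≤ (S (Matrix.single i i 1)).trace := h.sum_trace_extract_le _ hpos
      _ = 1 := by rw [hS.2, trace_single_eq_same]
  rw [← re_classicalOverlap hD]
  simpa using (Complex.le_def.1 hle).1

/-- Quantum information only fits into one block at a time: in the bound on the size of a quantum
code the greatest dimension of a block replaces their sum. -/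
theorem IsBlockSystem.mul_entanglementFidelity_le (h : IsBlockSystem ι π) (hD : 1 ≤ D)
    {S : Mat D →ₗ[ℂ] Mat d} (hS : IsChannel S) (hSum : ∀ X, ∑ k, ι k (π k (S X)) = S X)
    {R : Mat d →ₗ[ℂ] Mat D} (hR : IsChannel R) {m : ℕ} (hm : ∀ k, dk k ≤ m) :
    D * entanglementFidelity (R ∘ₗ S) ≤ m := by
  have hpos := hS.1.posSemidef (PosSemidef.one : (1 : Mat D).PosSemidef)
  have hle : quantumOverlap (R ∘ₗ S) ≤ ((m * D : ℝ) : ℂ) := by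
    rw [comp_eq_sum_comp_blocks hSum, quantumOverlap_sum]
    calc ∑ k, quantumOverlap ((R ∘ₗ ι k) ∘ₗ (π k ∘ₗ S))
        ≤ ∑ k, (m : ℂ) * (π k (S 1)).trace := Finset.sum_le_sum fun k _ =>
          (quantumOverlap_comp_le ((h.isCompletelyPositive_extract k).comp hS.1)
            (hR.comp (h.isChannel_embed k))).trans (mul_le_mul_of_nonneg_right
              (by exact_mod_cast hm k)
              ((h.isCompletelyPositive_extract k).posSemidef hpos).trace_nonneg)
      _ ≤ (m : ℂ) * (S 1).trace := by
          rw [← Finset.mul_sum]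
          exact mul_le_mul_of_nonneg_left (h.sum_trace_extract_le _ hpos) (Nat.cast_nonneg m)
      _ = ((m * D : ℝ) : ℂ) := by rw [hS.2, trace_one, Fintype.card_fin]; push_cast; rfl
  have h1 := (Complex.le_def.1 hle).1
  rw [re_quantumOverlap hD, Complex.ofReal_re] at h1
  have hD0 : (0 : ℝ) < D := by exact_mod_cast hD
  nlinarith

theorem isBlockSystem_id : IsBlockSystem (κ := Unit) (dk := fun _ => d)
    (fun _ => LinearMap.id) (fun _ => LinearMap.id) where
  isChannel_embed _ := ⟨isCompletelyPositive_id, fun _ => rfl⟩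
  isCompletelyPositive_extract _ := isCompletelyPositive_id
  extract_embed_self _ _ := rfl
  extract_embed_ne _ _ h := absurd rfl h
  sum_trace_extract_le _ _ := by simp

/-- A single block of a block system. -/
theorem IsBlockSystem.single (h : IsBlockSystem ι π) (k : κ) :
    IsBlockSystem (κ := Unit) (dk := fun _ => dk k) (fun _ => ι k) (fun _ => π k) where
  isChannel_embed _ := h.isChannel_embed k
  isCompletelyPositive_extract _ := h.isCompletelyPositive_extract k
  extract_embed_self _ := h.extract_embed_self k
  extract_embed_ne _ _ h := absurd rfl h
  sum_trace_extract_le X hX := by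
    rw [Fintype.sum_unique]
    exact (Finset.single_le_sum (f := fun l => (π l X).trace) (fun l _ =>
      ((h.isCompletelyPositive_extract l).posSemidef hX).trace_nonneg)
      (Finset.mem_univ k)).trans (h.sum_trace_extract_le X hX)

/-! ### Codes supported on the blocks -/

/-- The matrix that maps a vector of `ℂ^D` to its coordinates selected by `e`, a coisometry when
`e` is injective. -/
def selectMatrix {n : ℕ} (e : Fin n → Fin D) : Matrix (Fin n) (Fin D) ℂ :=
  Matrix.of fun a i => if e a = i then 1 else 0

/-- The compression of a `D × D` matrix to the coordinates selected by `e`. -/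
def compress {n : ℕ} (e : Fin n → Fin D) : Mat D →ₗ[ℂ] Mat n :=
  krausMap fun _ : Unit => selectMatrix e

/-- The inclusion of `M_n` into `M_D` as the corner on the coordinates selected by `e`. -/
def inflate {n : ℕ} (e : Fin n → Fin D) : Mat n →ₗ[ℂ] Mat D :=
  krausMap fun _ : Unit => (selectMatrix e)ᴴ

theorem compress_apply {n : ℕ} (e : Fin n → Fin D) (X : Mat D) :
    compress e X = X.submatrix e e := by
  ext a b
  simp [compress, krausMap_apply, selectMatrix, Matrix.mul_apply, apply_ite]

theorem inflate_apply {n : ℕ} (e : Fin n → Fin D) (x : Mat n) (i j : Fin D) :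
    inflate e x i j = ∑ a, ∑ b, if e a = i ∧ e b = j then x a b else 0 := by
  rw [Finset.sum_comm]
  simp only [inflate, krausMap_apply, selectMatrix, Matrix.mul_apply, ite_and, Finset.univ_unique,
    Finset.sum_singleton, conjTranspose_apply, of_apply, conjTranspose_conjTranspose]
  refine Finset.sum_congr rfl fun b _ => ?_
  by_cases hb : e b = j <;> simp [hb, apply_ite]

theorem trace_inflate {n : ℕ} {e : Fin n → Fin D} (he : Function.Injective e) (x : Mat n) :
    (inflate e x).trace = x.trace := by
  have h1 : selectMatrix e * (selectMatrix e)ᴴ = 1 := by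
    ext a b
    simp [selectMatrix, Matrix.mul_apply, Matrix.one_apply, he.eq_iff, apply_ite, eq_comm]
  simp only [inflate, krausMap_apply, conjTranspose_conjTranspose, Finset.univ_unique,
    Finset.sum_singleton]
  rw [trace_mul_comm, ← Matrix.mul_assoc, h1, Matrix.one_mul]

theorem inflate_compress_single {n : ℕ} (e : Fin n → Fin D) (i j : Fin D) :
    inflate e (compress e (Matrix.single i j 1)) i j =
      ∑ a, ∑ b, if e a = i ∧ e b = j then 1 else 0 := by
  rw [inflate_apply]
  refine Finset.sum_congr rfl fun a _ => Finset.sum_congr rfl fun b _ => ?_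
  rw [compress_apply, submatrix_apply, Matrix.single_apply]
  simp only [eq_comm (a := i), eq_comm (a := j)]
  split_ifs <;> rfl

theorem classicalOverlap_inflate_compress {n : ℕ} {e : Fin n → Fin D}
    (he : Function.Injective e) : classicalOverlap (inflate e ∘ₗ compress e) = n := by
  simp only [classicalOverlap, LinearMap.comp_apply, inflate_compress_single]
  rw [← Finset.sum_comm_cycle]
  simp [ite_and, he.eq_iff]

theorem quantumOverlap_inflate_compress {n : ℕ} (e : Fin n → Fin D) :
    quantumOverlap (inflate e ∘ₗ compress e) = n ^ 2 := by
  have h (i j : Fin D) : (∑ a, ∑ b, if e a = i ∧ e b = j then (1 : ℂ) else 0) =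
      (∑ a, if e a = i then 1 else 0) * ∑ b, if e b = j then 1 else 0 := by
    rw [Finset.sum_mul_sum]
    refine Finset.sum_congr rfl fun a _ => Finset.sum_congr rfl fun b _ => ?_
    split_ifs <;> simp_all
  have h1 : ∑ i, ∑ a, (if e a = i then (1 : ℂ) else 0) = n := by
    rw [Finset.sum_comm]
    simp
  simp only [quantumOverlap, LinearMap.comp_apply, inflate_compress_single, h]
  rw [← Finset.sum_mul_sum, h1, sq]

/-- Encoding coordinates of `ℂ^D` into the blocks gives a code whose overlaps are at least those
of the pinching onto these coordinates, whatever is done with the remaining coordinates. -/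
theorem IsBlockSystem.exists_code (h : IsBlockSystem ι π) (hd : 1 ≤ d) (hD : 1 ≤ D)
    {e : (Σ k, Fin (dk k)) → Fin D} (he : Function.Injective e) :
    ∃ (E : Mat D →ₗ[ℂ] Mat d) (R : Mat d →ₗ[ℂ] Mat D), IsChannel E ∧ IsChannel R ∧
      ∀ P : Mat d →ₗ[ℂ] Mat d, IsChannel P → (∀ k x, P (ι k x) = ι k x) →
        (∑ k, dk k : ℕ) ≤ D * classicalFidelity (R ∘ₗ P ∘ₗ E) ∧
        (∑ k, dk k ^ 2 : ℕ) ≤ D ^ 2 * entanglementFidelity (R ∘ₗ P ∘ₗ E) := by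
  have hinj (k : κ) : Function.Injective fun a => e ⟨k, a⟩ :=
    he.comp sigma_mk_injective
  let E₁ : Mat D →ₗ[ℂ] Mat d := ∑ k, ι k ∘ₗ compress fun a => e ⟨k, a⟩
  let R₁ : Mat d →ₗ[ℂ] Mat D := ∑ k, inflate (fun a => e ⟨k, a⟩) ∘ₗ π k
  have hE₁ : IsCompletelyPositive E₁ := .sum fun k =>
    (h.isChannel_embed k).1.comp (isCompletelyPositive_krausMap _)
  have hR₁ : IsCompletelyPositive R₁ := .sum fun k =>
    (isCompletelyPositive_krausMap _).comp (h.isCompletelyPositive_extract k)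
  -- `E₂` and `R₂` take care of the coordinates outside the blocks.
  obtain ⟨E₂, hE₂, hE⟩ := hE₁.exists_isChannel_add (fun X hX => by
    simp only [E₁, LinearMap.sum_apply, LinearMap.comp_apply, trace_sum,
      (h.isChannel_embed _).2, compress_apply]
    calc ∑ k, (X.submatrix (fun a => e ⟨k, a⟩) fun a => e ⟨k, a⟩).trace
        = ∑ s, X (e s) (e s) := (Fintype.sum_sigma fun s => X (e s) (e s)).symm
      _ = ∑ i ∈ Finset.univ.map ⟨e, he⟩, X i i := by rw [Finset.sum_map]; rfl
      _ ≤ X.trace := Finset.sum_le_sum_of_subset_of_nonneg (Finset.subset_univ _)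
          fun i _ _ => hX.diag_nonneg) hd
  obtain ⟨R₂, hR₂, hR⟩ := hR₁.exists_isChannel_add (fun X hX => by
    simp only [R₁, LinearMap.sum_apply, LinearMap.comp_apply, trace_sum, trace_inflate (hinj _)]
    exact h.sum_trace_extract_le X hX) hD
  refine ⟨E₁ + E₂, R₁ + R₂, hE, hR, fun P hP hfix => ?_⟩
  have hdecomp : (R₁ + R₂) ∘ₗ P ∘ₗ (E₁ + E₂) =
      (∑ k, inflate (fun a => e ⟨k, a⟩) ∘ₗ compress fun a => e ⟨k, a⟩) +
        (R₁ ∘ₗ P ∘ₗ E₂ + R₂ ∘ₗ P ∘ₗ (E₁ + E₂)) := by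
    have h1 : R₁ ∘ₗ P ∘ₗ E₁ =
        ∑ k, inflate (fun a => e ⟨k, a⟩) ∘ₗ compress fun a => e ⟨k, a⟩ := by
      refine LinearMap.ext fun X => ?_
      simp only [R₁, E₁, LinearMap.sum_apply, LinearMap.comp_apply, map_sum, hfix]
      refine Finset.sum_congr rfl fun k _ => ?_
      rw [Finset.sum_eq_single k (fun l _ hl => by rw [h.extract_embed_ne k l hl, map_zero])
        (by simp), h.extract_embed_self]
    rw [← h1]
    simp only [LinearMap.add_comp, LinearMap.comp_add]
    abel
  have hrest : IsCompletelyPositive (R₁ ∘ₗ P ∘ₗ E₂ + R₂ ∘ₗ P ∘ₗ (E₁ + E₂)) :=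
    (hR₁.comp (hP.1.comp hE₂)).add (hR₂.comp (hP.1.comp hE.1))
  rw [← re_classicalOverlap hD, ← re_quantumOverlap hD, hdecomp, classicalOverlap_add,
    quantumOverlap_add, classicalOverlap_sum, quantumOverlap_sum]
  simp only [classicalOverlap_inflate_compress (hinj _), quantumOverlap_inflate_compress]
  have h1 := (Complex.le_def.1 (classicalOverlap_nonneg hrest)).1
  have h2 := (Complex.le_def.1 (quantumOverlap_nonneg hrest)).1
  rw [Complex.add_re, Complex.add_re]
  constructor
  · have : (∑ k, (dk k : ℂ)).re = ((∑ k, dk k : ℕ) : ℝ) := by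
      rw [← Nat.cast_sum, Complex.natCast_re]
    rw [this]
    simpa using h1
  · have : (∑ k, (dk k : ℂ) ^ 2).re = ((∑ k, dk k ^ 2 : ℕ) : ℝ) := by
      rw [← Complex.natCast_re]
      push_cast
      rfl
    rw [this]
    simpa using h2

end Fidelity

/-! ### Codes for large times and codes for the peripheral projection -/

section Capacity

variable {d D : ℕ} {T : Module.End ℂ (Mat d)} {δ : ℝ}

theorem tendsto_classicalFidelity {N : ℕ → Mat D →ₗ[ℂ] Mat D} {M : Mat D →ₗ[ℂ] Mat D}
    (h : ∀ X, Tendsto (fun i => N i X) atTop (𝓝 (M X))) :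
    Tendsto (fun i => classicalFidelity (N i)) atTop (𝓝 (classicalFidelity M)) := by
  refine (tendsto_finsetSum _ fun i _ => ?_).const_mul _
  exact (Complex.continuous_re.tendsto _).comp (tendsto_pi_nhds.1 (tendsto_pi_nhds.1 (h _) i) i)

theorem tendsto_entanglementFidelity {N : ℕ → Mat D →ₗ[ℂ] Mat D} {M : Mat D →ₗ[ℂ] Mat D}
    (h : ∀ X, Tendsto (fun i => N i X) atTop (𝓝 (M X))) :
    Tendsto (fun i => entanglementFidelity (N i)) atTop (𝓝 (entanglementFidelity M)) := by
  have hamp : Tendsto (fun i => ampliation D (N i)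
      (Matrix.vecMulVec (maxEntangled D) (star (maxEntangled D)))) atTop (𝓝 (ampliation D M
      (Matrix.vecMulVec (maxEntangled D) (star (maxEntangled D))))) :=
    tendsto_pi_nhds.2 fun p => tendsto_pi_nhds.2 fun q =>
      tendsto_pi_nhds.1 (tendsto_pi_nhds.1 (h _) p.2) q.2
  have hc : Continuous fun A : Matrix (Fin D × Fin D) (Fin D × Fin D) ℂ =>
      (star (maxEntangled D) ⬝ᵥ A.mulVec (maxEntangled D)).re := by fun_prop
  exact (hc.tendsto _).comp hamp

/-- By compactness of the set of channels, codes for all powers of `T` have a limit, which is a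
code for the limit `P` of a subsequence of the powers. -/
theorem exists_limit_code {F : (Mat D →ₗ[ℂ] Mat D) → ℝ}
    (hF : ∀ (N : ℕ → Mat D →ₗ[ℂ] Mat D) (M : Mat D →ₗ[ℂ] Mat D),
      (∀ X, Tendsto (fun i => N i X) atTop (𝓝 (M X))) →
        Tendsto (fun i => F (N i)) atTop (𝓝 (F M)))
    {P : Mat d →ₗ[ℂ] Mat d} {n : ℕ → ℕ}
    (hP : ∀ X, Tendsto (fun i => (T ^ n i) X) atTop (𝓝 (P X))) {c : ℝ}
    (h : ∀ t : ℕ, ∃ E : Mat D →ₗ[ℂ] Mat d, IsChannel E ∧ ∃ R : Mat d →ₗ[ℂ] Mat D, IsChannel R ∧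
      c ≤ F (R ∘ₗ (T ^ t) ∘ₗ E)) :
    ∃ E : Mat D →ₗ[ℂ] Mat d, IsChannel E ∧ ∃ R : Mat d →ₗ[ℂ] Mat D, IsChannel R ∧
      c ≤ F (R ∘ₗ P ∘ₗ E) := by
  choose E hE R hR hc using h
  obtain ⟨E', hE', φ, hφ, hElim⟩ :=
    exists_subseq_tendsto_isChannel (S := fun i => E (n i)) fun i => hE _
  obtain ⟨R', hR', ψ, hψ, hRlim⟩ :=
    exists_subseq_tendsto_isChannel (S := fun i => R (n (φ i))) fun i => hR _
  refine ⟨E', hE', R', hR', ge_of_tendsto' (hF (fun i => R (n (φ (ψ i))) ∘ₗ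
    (T ^ n (φ (ψ i))) ∘ₗ E (n (φ (ψ i)))) _ fun X => ?_) fun i => hc _⟩
  have hsub := hφ.tendsto_atTop.comp hψ.tendsto_atTop
  have hlim := tendsto_apply_of_tendsto hRlim (tendsto_apply_of_tendsto
    (fun Y => (hP Y).comp hsub) ((hElim X).comp hψ.tendsto_atTop))
  exact hlim

/-- If the code sizes available at time `t` form a decreasing sequence of bounded sets, the
supremum of their logarithms is eventually the logarithm of the greatest size that is available
at all times. -/
theorem tendsto_sSup_log {S : ℕ → Set ℕ} (hS : Antitone S) {B : ℕ} (hB : ∀ D ∈ S 0, D ≤ B)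
    {M : ℕ} (hM : 1 ≤ M) (hMS : ∀ t, M ∈ S t) (hmax : ∀ D, (∀ t, D ∈ S t) → D ≤ M) :
    Tendsto (fun t => sSup {c : EReal | ∃ D : ℕ, 1 ≤ D ∧ D ∈ S t ∧
      c = ((Real.log D : ℝ) : EReal)}) atTop (𝓝 ((Real.log M : ℝ) : EReal)) := by
  have hev : ∀ᶠ t in atTop, ∀ D ∈ Finset.Ioc M B, D ∉ S t := by
    rw [Filter.eventually_all_finset]
    intro D hD
    obtain ⟨t, ht⟩ : ∃ t, D ∉ S t := by
      by_contra! hcon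
      exact absurd (hmax D hcon) (not_le.2 (Finset.mem_Ioc.1 hD).1)
    filter_upwards [eventually_ge_atTop t] with s hs hDs
    exact ht (hS hs hDs)
  refine tendsto_const_nhds.congr' ?_
  filter_upwards [hev] with t ht
  refine le_antisymm (le_sSup ⟨M, hM, hMS t, rfl⟩) (sSup_le ?_)
  rintro _ ⟨D, hD, hDt, rfl⟩
  have hDM : D ≤ M := by
    by_contra! hcon
    exact ht D (Finset.mem_Ioc.2 ⟨hcon, hB D (hS (Nat.zero_le t) hDt)⟩) hDt
  rw [EReal.coe_le_coe_iff]
  exact Real.log_le_log (by exact_mod_cast hD) (by exact_mod_cast hDM)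

theorem antitone_classicalCode (hT : IsChannel T) (δ : ℝ) :
    Antitone fun t : ℕ => {D : ℕ | ∃ E : Mat D →ₗ[ℂ] Mat d, IsClassicalCode D δ (T ^ t) E} := by
  refine antitone_nat_of_succ_le fun t D => ?_
  rintro ⟨E, hE, R, hR, h⟩
  refine ⟨E, hE, R ∘ₗ T, hR.comp hT, ?_⟩
  rwa [pow_succ'] at h

theorem antitone_quantumCode (hT : IsChannel T) (δ : ℝ) :
    Antitone fun t : ℕ => {D : ℕ | ∃ E : Mat D →ₗ[ℂ] Mat d, IsQuantumCode D δ (T ^ t) E} := by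
  refine antitone_nat_of_succ_le fun t D => ?_
  rintro ⟨E, hE, R, hR, h⟩
  refine ⟨E, hE, R ∘ₗ T, hR.comp hT, ?_⟩
  rwa [pow_succ'] at h

theorem IsClassicalCode.le_floor (hT : IsChannel T) (hδ : δ < 1) {E : Mat D →ₗ[ℂ] Mat d}
    (h : IsClassicalCode D δ T E) : D ≤ ⌊(d : ℝ) / (1 - δ)⌋₊ := by
  obtain rfl | hD := Nat.eq_zero_or_pos D
  · exact Nat.zero_le _
  obtain ⟨hE, R, hR, hF⟩ := h
  have h1 := isBlockSystem_id.mul_classicalFidelity_le hD hE (by simp) (hR.comp hT)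
  have hD0 : (0 : ℝ) ≤ D := Nat.cast_nonneg D
  rw [Fintype.sum_unique] at h1
  refine Nat.le_floor ((le_div_iff₀ (by linarith)).2 (le_trans ?_ h1))
  exact mul_le_mul_of_nonneg_left hF hD0

theorem IsQuantumCode.le_floor (hT : IsChannel T) (hδ : δ < 1) {E : Mat D →ₗ[ℂ] Mat d}
    (h : IsQuantumCode D δ T E) : D ≤ ⌊(d : ℝ) / (1 - δ)⌋₊ := by
  obtain rfl | hD := Nat.eq_zero_or_pos D
  · exact Nat.zero_le _
  obtain ⟨hE, R, hR, hF⟩ := h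
  have h1 := isBlockSystem_id.mul_entanglementFidelity_le hD hE (by simp) (hR.comp hT)
    fun _ => le_rfl
  have hD0 : (0 : ℝ) ≤ D := Nat.cast_nonneg D
  refine Nat.le_floor ((le_div_iff₀ (by linarith)).2 (le_trans ?_ h1))
  exact mul_le_mul_of_nonneg_left hF hD0

variable {κ : Type*} [Fintype κ] {dk : κ → ℕ} {ι : ∀ k, Mat (dk k) →ₗ[ℂ] Mat d}
  {π : ∀ k, Mat d →ₗ[ℂ] Mat (dk k)}

/-- A code of size `D` on the blocks of a block system on which the projection `P` acts trivially
works at every time, because a channel restores these blocks after any number of steps. -/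
theorem IsBlockSystem.exists_code_pow (h : IsBlockSystem ι π) (hd : 1 ≤ d) (hD : 1 ≤ D)
    (hT : IsChannel T) {P : Mat d →ₗ[ℂ] Mat d} (hP : IsChannel P) {n : ℕ → ℕ}
    (hn : Tendsto n atTop atTop) (hPlim : ∀ X, Tendsto (fun i => (T ^ n i) X) atTop (𝓝 (P X)))
    (hfix : ∀ k x, P (ι k x) = ι k x) (hcard : ∑ k, dk k ≤ D) (t : ℕ) :
    ∃ E : Mat D →ₗ[ℂ] Mat d, IsChannel E ∧ ∃ R : Mat d →ₗ[ℂ] Mat D, IsChannel R ∧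
      (∑ k, dk k : ℕ) ≤ D * classicalFidelity (R ∘ₗ (T ^ t) ∘ₗ E) ∧
      (∑ k, dk k ^ 2 : ℕ) ≤ D ^ 2 * entanglementFidelity (R ∘ₗ (T ^ t) ∘ₗ E) := by
  obtain ⟨e⟩ : Nonempty ((Σ k, Fin (dk k)) ↪ Fin D) :=
    Function.Embedding.nonempty_of_card_le (by simpa using hcard)
  obtain ⟨E, R, hE, hR, hER⟩ := h.exists_code hd hD e.injective
  obtain ⟨S, hS, hSP⟩ := exists_isChannel_comp_pow_eq hT hn hPlim t
  refine ⟨E, hE, R ∘ₗ S, hR.comp hS, ?_⟩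
  have : (R ∘ₗ S) ∘ₗ (T ^ t) ∘ₗ E = R ∘ₗ P ∘ₗ E := by rw [← hSP]; rfl
  rw [this]
  exact hER P hP hfix

end Capacity

end QCap

theorem theorem1 {d : ℕ} (hd : 1 ≤ d) (T : Module.End ℂ (QCap.Mat d)) (hT : QCap.IsChannel T)
    (d₀ K : ℕ) (dk mk : Fin K → ℕ) (W : Matrix (Fin d) (QCap.BlockIndex d₀ K dk mk) ℂ)
    (ω : ∀ k, QCap.Mat (mk k)) (hW : QCap.IsPeripheralDecomposition T d₀ K dk mk W ω)
    (δ : ℝ) (hδ0 : 0 ≤ δ) (hδ1 : δ < 1) :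
    QCap.HasInfiniteTimeClassicalCapacity δ T
        (Real.log ((⌊((∑ k, dk k : ℕ) : ℝ) / (1 - δ)⌋₊ : ℕ) : ℝ)) ∧
      ∃ q : ℝ, QCap.HasInfiniteTimeQuantumCapacity δ T q ∧
        Real.log ((⌊((Finset.univ.sup dk : ℕ) : ℝ) / Real.sqrt (1 - δ)⌋₊ : ℕ) : ℝ) ≤ q ∧
        q ≤ Real.log (((Finset.univ.sup dk : ℕ) : ℝ) / (1 - δ)) := by
  have hδ : 0 < 1 - δ := by linarith
  obtain ⟨P, hP, hPmem, hPfix, n, hn, hPlim⟩ := QCap.exists_peripheral_projection hT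
  have hB := hW.isBlockSystem
  have hfix (k : Fin K) (x : QCap.Mat (dk k)) :
      P (QCap.blockEmbed W k (ω k) x) = QCap.blockEmbed W k (ω k) x :=
    hPfix _ (hW.blockEmbed_mem k x)
  have hsum (X : QCap.Mat d) :
      ∑ k, QCap.blockEmbed W k (ω k) (QCap.blockExtract W k (P X)) = P X :=
    hW.sum_embed_extract (hPmem X)
  -- Some block is nonzero, since `P` maps the identity to a matrix of trace `d ≠ 0`.
  obtain ⟨k₁, hk₁⟩ : ∃ k, 1 ≤ dk k := by
    by_contra! hcon
    have hzero : P 1 = 0 := by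
      rw [← hsum 1]
      refine Finset.sum_eq_zero fun k _ => ?_
      have : QCap.blockExtract W k (P 1) = 0 := by
        ext a
        have := a.isLt
        have := hcon k
        omega
      rw [this, map_zero]
    have htr := hP.trace_preserving 1
    rw [hzero, Matrix.trace_zero, Matrix.trace_one, Fintype.card_fin] at htr
    exact absurd htr.symm (by exact_mod_cast (by omega : d ≠ 0))
  constructor
  · set N := ∑ k, dk k with hN
    have hN1 : 1 ≤ N := hk₁.trans (Finset.single_le_sum (f := dk) (fun _ _ => Nat.zero_le _)
      (Finset.mem_univ k₁))
    set M := ⌊(N : ℝ) / (1 - δ)⌋₊ with hM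
    have hNM : N ≤ M := Nat.le_floor
      ((le_div_iff₀ hδ).2 (mul_le_of_le_one_right (Nat.cast_nonneg N) (by linarith)))
    refine QCap.tendsto_sSup_log (QCap.antitone_classicalCode hT δ)
      (B := ⌊(d : ℝ) / (1 - δ)⌋₊) ?_ (hN1.trans hNM) (fun t => ?_) fun D hD => ?_
    · rintro D ⟨E, hE⟩
      exact hE.le_floor (hT.pow 0) hδ1
    · obtain ⟨E, hE, R, hR, hF, -⟩ := hB.exists_code_pow hd (hN1.trans hNM) hT hP hn hPlim hfix
        hNM t
      refine ⟨E, hE, R, hR, ?_⟩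
      have hM0 : (0 : ℝ) < M := by exact_mod_cast hN1.trans hNM
      have hle : (M : ℝ) * (1 - δ) ≤ N :=
        (le_div_iff₀ hδ).1 (Nat.floor_le (div_nonneg (Nat.cast_nonneg N) hδ.le))
      exact le_of_mul_le_mul_left (hle.trans hF) hM0
    · obtain rfl | hD1 := Nat.eq_zero_or_pos D
      · exact Nat.zero_le _
      obtain ⟨E, hE, R, hR, hF⟩ := QCap.exists_limit_code
        (fun N M h => QCap.tendsto_classicalFidelity h) hPlim hD
      have hle := hB.mul_classicalFidelity_le hD1 (hP.comp hE) (fun X => hsum (E X)) hR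
      exact Nat.le_floor ((le_div_iff₀ hδ).2
        ((mul_le_mul_of_nonneg_left hF (Nat.cast_nonneg D)).trans hle))
  · obtain ⟨k₀, -, hk₀⟩ := Finset.exists_mem_eq_sup Finset.univ ⟨k₁, Finset.mem_univ k₁⟩ dk
    set m := Finset.univ.sup dk with hm
    have hmk (k : Fin K) : dk k ≤ m := Finset.le_sup (Finset.mem_univ k)
    have hm1 : 1 ≤ m := hk₁.trans (hmk k₁)
    set L := ⌊(m : ℝ) / Real.sqrt (1 - δ)⌋₊ with hL
    have hsqrt : 0 < Real.sqrt (1 - δ) := Real.sqrt_pos.2 hδ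
    have hmL : m ≤ L := Nat.le_floor ((le_div_iff₀ hsqrt).2 (mul_le_of_le_one_right
      (Nat.cast_nonneg m) (Real.sqrt_le_one.2 (by linarith))))
    let S : ℕ → Set ℕ := fun t =>
      {D : ℕ | ∃ E : QCap.Mat D →ₗ[ℂ] QCap.Mat d, QCap.IsQuantumCode D δ (T ^ t) E}
    have hS0 : ∀ D ∈ S 0, D ≤ ⌊(d : ℝ) / (1 - δ)⌋₊ := by
      rintro D ⟨E, hE⟩
      exact hE.le_floor (hT.pow 0) hδ1
    have hLS (t : ℕ) : L ∈ S t := by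
      obtain ⟨E, hE, R, hR, -, hF⟩ := (hB.single k₀).exists_code_pow hd (hm1.trans hmL) hT hP hn
        hPlim (fun _ => hfix k₀) (by simpa [← hk₀] using hmL) t
      refine ⟨E, hE, R, hR, ?_⟩
      rw [Fintype.sum_unique, ← hk₀] at hF
      have hL0 : (0 : ℝ) < L ^ 2 := pow_pos (by exact_mod_cast hm1.trans hmL) 2
      have hle : (L : ℝ) * Real.sqrt (1 - δ) ≤ m :=
        (le_div_iff₀ hsqrt).1 (Nat.floor_le (div_nonneg (Nat.cast_nonneg m) hsqrt.le))
      have hsq : (L : ℝ) ^ 2 * (1 - δ) ≤ (m ^ 2 : ℕ) := by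
        calc (L : ℝ) ^ 2 * (1 - δ) = (L * Real.sqrt (1 - δ)) ^ 2 := by
              rw [mul_pow, Real.sq_sqrt hδ.le]
          _ ≤ (m : ℝ) ^ 2 := by gcongr
          _ = _ := by push_cast; rfl
      exact le_of_mul_le_mul_left (hsq.trans hF) hL0
    have hbdd : BddAbove {D | ∀ t, D ∈ S t} := ⟨_, fun D hD => hS0 D (hD 0)⟩
    -- The greatest code size that is available at all times determines the limit.
    have hMS : ∀ t, sSup {D | ∀ t, D ∈ S t} ∈ S t :=
      Nat.sSup_mem (s := {D | ∀ t, D ∈ S t}) ⟨L, hLS⟩ hbdd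
    have hLM : L ≤ sSup {D | ∀ t, D ∈ S t} := le_csSup hbdd hLS
    set M := sSup {D | ∀ t, D ∈ S t} with hM
    have hM1 : 1 ≤ M := (hm1.trans hmL).trans hLM
    refine ⟨Real.log M, QCap.tendsto_sSup_log (QCap.antitone_quantumCode hT δ) hS0 hM1 hMS
      fun D hD => le_csSup hbdd hD, ?_, ?_⟩
    · exact Real.log_le_log (by exact_mod_cast hm1.trans hmL) (by exact_mod_cast hLM)
    · obtain ⟨E, hE, R, hR, hF⟩ := QCap.exists_limit_code
        (fun N M h => QCap.tendsto_entanglementFidelity h) hPlim hMS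
      have hle := hB.mul_entanglementFidelity_le hM1 (hP.comp hE) (fun X => hsum (E X)) hR hmk
      exact Real.log_le_log (by exact_mod_cast hM1) ((le_div_iff₀ hδ).2
        ((mul_le_mul_of_nonneg_left hF (Nat.cast_nonneg M)).trans hle))
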